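/- Let $(\Omega,\mathcal F,\mathbb P)$ be a probability space, $T>0$, $\alpha>\tfrac12$, and let $X=(X_t)_{t\in[0,T]}$ be a real-valued stochastic process such that - almost every path $t\mapsto X_t(\omega)$ is $\alpha$-Hölder continuous on $[0,T]$ (with a constant that may depend on $\omega$); - there is a function $b\in L^1([0,T])$ such that for almost every $t\in[0,T]$ the random variable $X_t$ has a density $p_t$ with respect to Lebesgue measure with $\sup_{y\in\mathbb R}p_t(y)\le b(t)$. Let $f'_-:\mathbb R\to\mathbb R$ be of bounded variation on every compact interval and put $f(x)=\int_0^x f'_-(y)\,dy$ for $x\in\mathbb R$ (if $f'_-$ is left-continuous, it is the left derivative of $f$; left-continuity is not required). Then, almost surely, for all $t\in[0,T]$, $$f(X_t)=f(X_0)+\int_0^t f'_-(X_s)\,dX_s ,$$ where the integral exists in the generalized Lebesgue–Stieltjes sense for every order $\beta\in(0,1)$ with $1-\alpha<\beta<\alpha$ (with one exceptional null set for all such $\beta$ and all $t$), and its value is the same for all these $\beta$. Here, for measurable $\varphi,g:[0,T]\to\mathbb R$ and $\beta\in(0,1)$, the generalized Lebesgue–Stieltjes integral $\int_0^t\varphi\,dg$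 exists with order $\beta$ if $$\int_0^T\frac{|\varphi(s)|}{s^\beta}\,ds+\int_0^T\!\int_0^s\frac{|\varphi(s)-\varphi(u)|}{(s-u)^{1+\beta}}\,du\,ds<\infty ,$$ $$\sup_{0\le s<r\le T}\left(\frac{|g(r)-g(s)|}{(r-s)^{1-\beta}}+\int_s^r\frac{|g(u)-g(s)|}{(u-s)^{2-\beta}}\,du\right)<\infty ,$$ and the integrand in the following Lebesgue integral is integrable on $(0,t)$; its value is then $$\int_0^t\varphi\,dg=-\int_0^t\big(D^\beta_{0+}\varphi\big)(s)\,\big(D^{1-\beta}_{t-}g_{t-}\big)(s)\,ds ,\qquad g_{t-}(s)=g(s)-g(t-),$$ with $$(D^\beta_{0+}\varphi)(s)=\frac1{\Gamma(1-\beta)}\left(\frac{\varphi(s)}{s^\beta}+\beta\int_0^s\frac{\varphi(s)-\varphi(u)}{(s-u)^{1+\beta}}\,du\right),$$ $$(D^{1-\beta}_{t-}h)(s)=\frac1{\Gamma(\beta)}\left(\frac{h(s)}{(t-s)^{1-\beta}}+(1-\beta)\int_s^t\frac{h(s)-h(u)}{(u-s)^{2-\beta}}\,du\right).$$ For $t=0$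 the integral is $0$. -/

import Mathlib

open MeasureTheory Set
open scoped ENNReal NNReal

noncomputable section

/-- The norm `‖f‖_{1,β}` of the fractional Besov space `W₁^β([0,T])`, with values in `[0,∞]`.
Functions on `[0,T]` are represented by functions on `ℝ`; only the values on `[0,T]` are used. -/
def besovNormOne (T β : ℝ) (f : ℝ → ℝ) : ℝ≥0∞ :=
  ⨆ (s : ℝ) (t : ℝ) (_ : 0 ≤ s) (_ : s < t) (_ : t ≤ T),
    (ENNReal.ofReal (|f t - f s| / (t - s) ^ β)
      + ∫⁻ u in Ioc s t, ENNReal.ofReal (|f u - f s| / (u - s) ^ (1 + β)))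

/-- The norm `‖f‖_{2,β}` of the fractional Besov space `W₂^β([0,T])`, with values in `[0,∞]`. -/
def besovNormTwo (T β : ℝ) (f : ℝ → ℝ) : ℝ≥0∞ :=
  (∫⁻ s in Ioc 0 T, ENNReal.ofReal (|f s| / s ^ β))
    + ∫⁻ s in Ioc 0 T, ∫⁻ u in Ioc 0 s, ENNReal.ofReal (|f u - f s| / (s - u) ^ (1 + β))

/-- `f ∈ W₁^β([0,T])`. -/
def MemBesovOne (T β : ℝ) (f : ℝ → ℝ) : Prop :=
  Measurable ((Icc 0 T).domRestrict f) ∧ besovNormOne T β f < ∞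

/-- `f ∈ W₂^β([0,T])`. -/
def MemBesovTwo (T β : ℝ) (f : ℝ → ℝ) : Prop :=
  Measurable ((Icc 0 T).domRestrict f) ∧ besovNormTwo T β f < ∞

/-- The left-sided Riemann--Liouville fractional derivative `D^β_{0+} f`, in Weyl form. -/
def fracDerivLeft (β : ℝ) (f : ℝ → ℝ) (s : ℝ) : ℝ :=
  1 / Real.Gamma (1 - β) *
    (f s / s ^ β + β * ∫ u in (0 : ℝ)..s, (f s - f u) / (s - u) ^ (β + 1))

/-- The right-sided Riemann--Liouville fractional derivative `D^β_{t-} f`, in Weyl form, without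
its unimodular prefactor, a power of `-1`; the prefactors are collected into the sign in
`glsValue`. -/
def fracDerivRight (β t : ℝ) (f : ℝ → ℝ) (s : ℝ) : ℝ :=
  1 / Real.Gamma (1 - β) *
    (f s / (t - s) ^ β + β * ∫ u in s..t, (f s - f u) / (u - s) ^ (β + 1))

/-- The integrand `(D^β_{0+} φ)(s) (D^{1-β}_{t-} g_{t-})(s)`, where `g_{t-}(s) = g(s) - g(t-)`. -/
def glsIntegrand (β : ℝ) (φ g : ℝ → ℝ) (t s : ℝ) : ℝ :=
  fracDerivLeft β φ s * fracDerivRight (1 - β) t (fun u => g u - Function.leftLim g t) s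

/-- The value `-∫₀ᵗ (D^β_{0+} φ)(s) (D^{1-β}_{t-} g_{t-})(s) ds`. The sign is
`(-1)^β (-1)^(1-β) = -1`; with it, `∫₀ᵗ 1 ds` has the value `t`. -/
def glsValue (β : ℝ) (φ g : ℝ → ℝ) (t : ℝ) : ℝ :=
  -∫ s in (0 : ℝ)..t, glsIntegrand β φ g t s

/-- The generalized Lebesgue--Stieltjes integral `∫₀ᵗ φ dg` of functions on `[0,T]` exists,
computed with the fractional order `β`, and its value is `I`. -/
structure HasGLSIntegral (T β : ℝ) (φ g : ℝ → ℝ) (t I : ℝ) : Prop where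
  pos : 0 < β
  lt_one : β < 1
  mem_two : MemBesovTwo T β φ
  mem_one : MemBesovOne T (1 - β) g
  integrable : IntervalIntegrable (glsIntegrand β φ g t) volume 0 t
  value : glsValue β φ g t = I

/-- For almost every `t ∈ [0,T]` the law of `X t` has a density `p` with respect to Lebesgue
measure with `sup p ≤ b t`, where `b` is in `L¹([0,T])`. -/
def HasIntegrablyBoundedDensities {Ω : Type*} [MeasurableSpace Ω] (P : Measure Ω) (T : ℝ)
    (X : ℝ → Ω → ℝ) : Prop :=
  ∃ b : ℝ → ℝ, IntegrableOn b (Icc 0 T) ∧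
    ∀ᵐ t ∂(volume.restrict (Icc 0 T)), ∃ p : ℝ → ℝ, Measurable p ∧
      (∀ y, 0 ≤ p y) ∧ (∀ y, p y ≤ b t) ∧
      P.map (X t) = volume.withDensity (fun y => ENNReal.ofReal (p y))

end

/-!
The proof works path by path with the operator `D = fracDerivLeft`; time reversal reduces
`fracDerivRight` to it (`fracDerivRight_eq_fracDerivLeft`).

For `C¹` functions `φ` and `g` the generalized Lebesgue--Stieltjes integral is `∫ φ g'`
(`integral_fracDeriv_mul_of_contDiff`): an integration by parts puts both fractional derivatives
into Riemann--Liouville form, and Fubini's theorem on a triangle together with the Beta integral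
shows that fractional integration of order `β` inverts `D^β`. Everything else is obtained from
dominated convergence (`tendsto_integral_fracDeriv_mul`): it applies to `φₙ → φ` as soon as
`|φₙ s - φₙ u| ≤ H s * (s - u) ^ δ` with one integrable `H` and `δ > β`, and to pointwise
convergent integrators with a common `α`-Hölder bound, `α > 1 - β`.

* Averaging a Hölder path `g` over short intervals gives `C¹` paths with the same Hölder constant,
  so the chain rule `∫ F(g) dg = ∫_{g 0}^{g t} F` holds for `F` of class `C¹`
  (`integral_fracDeriv_comp_mul`).
* A monotone `p` with Stieltjes measure `μ` is approximated by `Fₙ = c + ∫ ψ(n (· - a)) dμ(a)`, with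
  `ψ` a smooth step. Since `|ψ(n (x - a)) - ψ(n (y - a))|` is at most `2 (|x - y| / |x - a|) ^ γ`,
  uniformly in `n`, one has `|Fₙ x - Fₙ y| ≤ |x - y| ^ γ * H x` with the Riesz potential
  `H x = 2 ∫ |x - a| ^ (-γ) dμ(a)`, which is locally integrable for `γ < 1`
  (`exists_isFracApprox`). Where `H` is finite `μ` has no atom, so `Fₙ → p` there.
* Along an `α`-Hölder path `x` this bound has the shape required above, with `δ = α γ > β` for `γ`
  close to `1`, provided that `∫ H (x s) ds < ∞` (`fracDeriv_chainRule`). For the paths of `X`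
  this holds almost surely, because `E ∫ H (X s) ds ≤ ‖b‖₁ ‖H‖₁`
  (`HasIntegrablyBoundedDensities.ae_lintegral_lt_top`).
-/

open Filter Topology

/-! ### Fractional derivatives: measurability, bounds and dominated convergence -/

theorem measurable_intervalIntegral_of_uncurry {F : ℝ → ℝ → ℝ}
    (hF : Measurable (Function.uncurry F)) : Measurable fun s => ∫ u in (0 : ℝ)..s, F s u := by
  have key : ∀ S : Set (ℝ × ℝ), MeasurableSet S →
      Measurable fun s => ∫ u, S.indicator (Function.uncurry F) (s, u) := fun S hS =>
    ((hF.indicator hS).stronglyMeasurable.integral_prod_right'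
      (f := S.indicator (Function.uncurry F))).measurable
  have h1 := key {p | 0 < p.2 ∧ p.2 ≤ p.1}
    ((measurableSet_lt measurable_const measurable_snd).inter
      (measurableSet_le measurable_snd measurable_fst))
  have h2 := key {p | p.1 < p.2 ∧ p.2 ≤ 0}
    ((measurableSet_lt measurable_fst measurable_snd).inter
      (measurableSet_le measurable_snd measurable_const))
  convert h1.sub h2 using 2 with s
  rw [intervalIntegral, ← integral_indicator measurableSet_Ioc,
    ← integral_indicator measurableSet_Ioc]
  rfl

theorem measurable_fracDerivLeft (β : ℝ) {φ : ℝ → ℝ} (hφ : Measurable φ) :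
    Measurable (fracDerivLeft β φ) := by
  unfold fracDerivLeft
  have : Measurable fun s => ∫ u in (0 : ℝ)..s, (φ s - φ u) / (s - u) ^ (β + 1) := by
    apply measurable_intervalIntegral_of_uncurry
    unfold Function.uncurry
    fun_prop
  fun_prop

/-- Time reversal turns the right-sided fractional derivative into the left-sided one. -/
theorem fracDerivRight_eq_fracDerivLeft (β t : ℝ) (h : ℝ → ℝ) (s : ℝ) :
    fracDerivRight β t h s = fracDerivLeft β (fun r => h (t - r)) (t - s) := by
  unfold fracDerivRight fracDerivLeft
  have := intervalIntegral.integral_comp_sub_left (a := 0) (b := t - s)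
    (fun u => (h s - h u) / (u - s) ^ (β + 1)) t
  simp only [sub_sub_cancel, sub_zero] at this ⊢
  rw [← this]
  congr 3
  refine intervalIntegral.integral_congr fun x _ => ?_
  congr 2
  ring

theorem measurable_fracDerivRight (β t : ℝ) {h : ℝ → ℝ} (hh : Measurable h) :
    Measurable (fracDerivRight β t h) := by
  have : fracDerivRight β t h = fun s => fracDerivLeft β (fun r => h (t - r)) (t - s) :=
    funext (fracDerivRight_eq_fracDerivLeft β t h)
  rw [this]
  exact (measurable_fracDerivLeft β (hh.comp (measurable_const.sub measurable_id))).comp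
    (measurable_const.sub measurable_id)

theorem intervalIntegrable_sub_rpow {r : ℝ} (hr : -1 < r) (s : ℝ) :
    IntervalIntegrable (fun u => (s - u) ^ r) volume 0 s := by
  simpa using ((intervalIntegral.intervalIntegrable_rpow' (a := 0) (b := s) hr).comp_sub_left
    s).symm

theorem integral_sub_rpow {r : ℝ} (hr : -1 < r) (s : ℝ) :
    ∫ u in (0 : ℝ)..s, (s - u) ^ r = s ^ (r + 1) / (r + 1) := by
  rw [intervalIntegral.integral_comp_sub_left (fun x => x ^ r) s, sub_self, sub_zero,
    integral_rpow (Or.inl hr), Real.zero_rpow (by linarith), sub_zero]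

/-- A Hölder bound at `s` turns into a power bound for the integrand of `fracDerivLeft`. The case
`u = s` causes no difficulty, being a null set. -/
theorem ae_norm_div_rpow_le {β δ s K : ℝ} {φ : ℝ → ℝ}
    (h : ∀ᵐ u ∂volume.restrict (Ioc 0 s), |φ s - φ u| ≤ K * (s - u) ^ δ) :
    ∀ᵐ u ∂volume, u ∈ uIoc 0 s → 0 ≤ s →
      ‖(φ s - φ u) / (s - u) ^ (β + 1)‖ ≤ K * (s - u) ^ (δ - β - 1) := by
  rw [ae_restrict_iff' measurableSet_Ioc] at h
  have hne : ∀ᵐ u ∂(volume : Measure ℝ), u ≠ s := by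
    simp [ae_iff]
  filter_upwards [h, hne] with u hu hus hmem hs
  rw [uIoc_of_le hs] at hmem
  have hpos : 0 < s - u := by
    have := lt_of_le_of_ne hmem.2 hus
    linarith
  rw [norm_div, Real.norm_eq_abs, Real.norm_of_nonneg (Real.rpow_nonneg hpos.le _),
    div_le_iff₀ (Real.rpow_pos_of_pos hpos _), mul_assoc, ← Real.rpow_add hpos]
  rw [show δ - β - 1 + (β + 1) = δ by ring]
  exact hu hmem

theorem abs_fracDerivLeft_le {β δ s K : ℝ} {φ : ℝ → ℝ} (hβ : 0 < β) (hβ1 : β < 1) (hδ : β < δ)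
    (hs : 0 < s)
    (h : ∀ᵐ u ∂volume.restrict (Ioc 0 s), |φ s - φ u| ≤ K * (s - u) ^ δ) :
    |fracDerivLeft β φ s| ≤ 1 / Real.Gamma (1 - β) *
      (|φ s| / s ^ β + β * (K * (s ^ (δ - β) / (δ - β)))) := by
  have hG : 0 < Real.Gamma (1 - β) := Real.Gamma_pos_of_pos (by linarith)
  have hr : -1 < δ - β - 1 := by linarith
  unfold fracDerivLeft
  rw [abs_mul, abs_of_pos (by positivity)]
  gcongr
  refine (abs_add_le _ _).trans ?_
  rw [abs_div, abs_of_nonneg (Real.rpow_nonneg hs.le β), abs_mul, abs_of_pos hβ]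
  gcongr
  rw [← Real.norm_eq_abs]
  have hint := integral_sub_rpow hr s
  rw [sub_add_cancel] at hint
  rw [← hint, ← intervalIntegral.integral_const_mul]
  refine intervalIntegral.norm_integral_le_of_norm_le hs.le ?_
    ((intervalIntegrable_sub_rpow hr s).const_mul K)
  filter_upwards [ae_norm_div_rpow_le (β := β) h] with u hu hmem
  exact hu (by rwa [uIoc_of_le hs.le]) hs.le

theorem tendsto_fracDerivLeft {β δ s K : ℝ} {φ : ℝ → ℝ} {φn : ℕ → ℝ → ℝ} (hδ : β < δ)
    (hs : 0 < s) (hm : ∀ n, Measurable (φn n))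
    (hlim : Tendsto (fun n => φn n s) atTop (𝓝 (φ s)))
    (hae : ∀ᵐ u ∂volume.restrict (Ioc 0 s), Tendsto (fun n => φn n u) atTop (𝓝 (φ u)))
    (h : ∀ n, ∀ᵐ u ∂volume.restrict (Ioc 0 s), |φn n s - φn n u| ≤ K * (s - u) ^ δ) :
    Tendsto (fun n => fracDerivLeft β (φn n) s) atTop (𝓝 (fracDerivLeft β φ s)) := by
  have hr : -1 < δ - β - 1 := by linarith
  unfold fracDerivLeft
  refine ((hlim.div_const _).add (Tendsto.const_mul _ ?_)).const_mul _
  refine intervalIntegral.tendsto_integral_filter_of_dominated_convergence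
    (fun u => K * (s - u) ^ (δ - β - 1)) (Eventually.of_forall fun n => ?_)
    (Eventually.of_forall fun n => ?_) ((intervalIntegrable_sub_rpow hr s).const_mul K) ?_
  · have := hm n
    exact Measurable.aestronglyMeasurable (by fun_prop)
  · filter_upwards [ae_norm_div_rpow_le (β := β) (h n)] with u hu hmem
    exact hu hmem hs.le
  · rw [ae_restrict_iff' measurableSet_Ioc] at hae
    filter_upwards [hae] with u hu hmem
    exact (hlim.sub (hu (by rwa [uIoc_of_le hs.le] at hmem))).div_const _

/-- A bound for the right-sided fractional derivative of order `η` on `(0,t)` of functions that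
vanish at `t` and are `α`-Hölder with constant `C`. -/
noncomputable def fracDerivRightBound (η α t C : ℝ) : ℝ :=
  1 / Real.Gamma (1 - η) * (C * t ^ (α - η) + η * (C * (t ^ (α - η) / (α - η))))

theorem abs_fracDerivRight_le {η α s t C : ℝ} {h : ℝ → ℝ} (hη : 0 < η) (hη1 : η < 1)
    (hα : η < α) (hs : 0 ≤ s) (hst : s < t) (hC : 0 ≤ C) (ht0 : h t = 0)
    (hh : ∀ u ∈ Icc 0 t, ∀ v ∈ Icc 0 t, |h u - h v| ≤ C * |u - v| ^ α) :
    |fracDerivRight η t h s| ≤ fracDerivRightBound η α t C := by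
  unfold fracDerivRightBound
  have hG : 0 < Real.Gamma (1 - η) := Real.Gamma_pos_of_pos (by linarith)
  have hts : 0 < t - s := by linarith
  have hαη : 0 < α - η := by linarith
  rw [fracDerivRight_eq_fracDerivLeft]
  refine (abs_fracDerivLeft_le (K := C) hη hη1 hα hts ?_).trans ?_
  · refine (ae_restrict_iff' measurableSet_Ioc).2 (ae_of_all _ fun u hu => ?_)
    have := hh (t - (t - s)) ⟨by linarith, by linarith⟩ (t - u)
      ⟨by linarith [hu.2], by linarith [hu.1]⟩
    refine this.trans_eq ?_
    rw [show t - (t - s) - (t - u) = -(t - s - u) by ring, abs_neg,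
      abs_of_nonneg (by linarith [hu.2])]
  · have hle : (t - s) ^ (α - η) ≤ t ^ (α - η) :=
      Real.rpow_le_rpow hts.le (by linarith) hαη.le
    gcongr
    rw [div_le_iff₀ (Real.rpow_pos_of_pos hts _)]
    have := hh s ⟨hs, hst.le⟩ t ⟨by linarith, le_rfl⟩
    rw [ht0, sub_zero, abs_sub_comm s t, abs_of_pos hts] at this
    rw [sub_sub_cancel]
    calc |h s| ≤ C * (t - s) ^ α := this
      _ = C * (t - s) ^ (α - η) * (t - s) ^ η := by
        rw [mul_assoc, ← Real.rpow_add hts, sub_add_cancel]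
      _ ≤ _ := by gcongr

theorem tendsto_fracDerivRight {η α s t C : ℝ} {h : ℝ → ℝ} {hn : ℕ → ℝ → ℝ}
    (hα : η < α) (hs : 0 ≤ s) (hst : s < t) (hm : ∀ n, Measurable (hn n))
    (hlim : ∀ u ∈ Icc 0 t, Tendsto (fun n => hn n u) atTop (𝓝 (h u)))
    (hh : ∀ n, ∀ u ∈ Icc 0 t, ∀ v ∈ Icc 0 t, |hn n u - hn n v| ≤ C * |u - v| ^ α) :
    Tendsto (fun n => fracDerivRight η t (hn n) s) atTop (𝓝 (fracDerivRight η t h s)) := by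
  have hts : 0 < t - s := by linarith
  simp only [fracDerivRight_eq_fracDerivLeft]
  refine tendsto_fracDerivLeft (K := C) hα hts
    (fun n => (hm n).comp (measurable_const.sub measurable_id))
    (hlim _ ⟨by linarith, by linarith⟩) ?_ fun n => ?_
  · refine (ae_restrict_iff' measurableSet_Ioc).2 (ae_of_all _ fun u hu => ?_)
    exact hlim _ ⟨by linarith [hu.2], by linarith [hu.1]⟩
  · refine (ae_restrict_iff' measurableSet_Ioc).2 (ae_of_all _ fun u hu => ?_)
    have := hh n (t - (t - s)) ⟨by linarith, by linarith⟩ (t - u)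
      ⟨by linarith [hu.2], by linarith [hu.1]⟩
    refine this.trans_eq ?_
    rw [show t - (t - s) - (t - u) = -(t - s - u) by ring, abs_neg,
      abs_of_nonneg (by linarith [hu.2])]

/-- The integrable function dominating `D^β φ · D^{1-β} h`, for `|φ| ≤ A`,
`|φ s - φ u| ≤ H s * (s - u) ^ δ` and `|D^{1-β} h| ≤ B`. -/
theorem intervalIntegrable_fracDeriv_bound {β t : ℝ} (hβ1 : β < 1) (δ A B : ℝ) (ht : 0 ≤ t)
    {H : ℝ → ℝ}
    (hH : IntegrableOn H (Ioc 0 t)) (hδ : β < δ) :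
    IntervalIntegrable (fun s => 1 / Real.Gamma (1 - β) *
      (A / s ^ β + β * (H s * (s ^ (δ - β) / (δ - β)))) * B) volume 0 t := by
  have h1 : IntervalIntegrable (fun s : ℝ => A / s ^ β) volume 0 t := by
    have := (intervalIntegral.intervalIntegrable_rpow' (a := 0) (b := t)
      (r := -β) (by linarith)).const_mul A
    refine this.congr fun s hs => ?_
    rw [uIoc_of_le ht] at hs
    rw [Real.rpow_neg hs.1.le, div_eq_mul_inv]
  have h2 : IntervalIntegrable (fun s : ℝ => H s * (s ^ (δ - β) / (δ - β))) volume 0 t := by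
    have hH' : IntervalIntegrable H volume 0 t := (intervalIntegrable_iff_integrableOn_Ioc_of_le
      ht).2 hH
    refine hH'.mul_continuousOn ?_
    exact ((Real.continuous_rpow_const (by linarith)).div_const _).continuousOn
  exact ((h1.add (h2.const_mul β)).const_mul _).mul_const B

theorem abs_fracDeriv_mul_le {β δ α t s A C K : ℝ} {φ h : ℝ → ℝ} (hβ : 0 < β) (hβ1 : β < 1)
    (hδ : β < δ) (hα : 1 - β < α) (hC : 0 ≤ C) (hs : 0 < s) (hst : s < t)
    (hA : |φ s| ≤ A)
    (h1 : ∀ᵐ u ∂volume.restrict (Ioc 0 s), |φ s - φ u| ≤ K * (s - u) ^ δ)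
    (ht0 : h t = 0)
    (hh : ∀ u ∈ Icc 0 t, ∀ v ∈ Icc 0 t, |h u - h v| ≤ C * |u - v| ^ α) :
    ‖fracDerivLeft β φ s * fracDerivRight (1 - β) t h s‖ ≤ 1 / Real.Gamma (1 - β) *
      (A / s ^ β + β * (K * (s ^ (δ - β) / (δ - β)))) * 
        fracDerivRightBound (1 - β) α t C := by
  have hG : 0 < Real.Gamma (1 - β) := Real.Gamma_pos_of_pos (by linarith)
  have e1 := abs_fracDerivLeft_le hβ hβ1 hδ hs h1
  have e2 := abs_fracDerivRight_le (by linarith : 0 < 1 - β) (by linarith) hα hs.le hst hC ht0 hh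
  rw [norm_mul, Real.norm_eq_abs, Real.norm_eq_abs]
  have e3 : 1 / Real.Gamma (1 - β) * (|φ s| / s ^ β + β * (K * (s ^ (δ - β) / (δ - β))))
      ≤ 1 / Real.Gamma (1 - β) * (A / s ^ β + β * (K * (s ^ (δ - β) / (δ - β)))) := by
    gcongr
  exact mul_le_mul (e1.trans e3) e2 (abs_nonneg _) ((abs_nonneg _).trans (e1.trans e3))

theorem ae_restrict_Ioc_ne (t : ℝ) : ∀ᵐ s ∂volume.restrict (Ioc 0 t), 0 < s ∧ s < t := by
  have hne : ∀ᵐ u ∂(volume : Measure ℝ), u ≠ t := by simp [ae_iff]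
  refine (ae_restrict_iff' measurableSet_Ioc).2 ?_
  filter_upwards [hne] with u hu hmem
  exact ⟨hmem.1, lt_of_le_of_ne hmem.2 hu⟩

theorem intervalIntegrable_fracDeriv_mul {β δ α t A C : ℝ} {φ h H : ℝ → ℝ} (hβ : 0 < β)
    (hβ1 : β < 1) (hδ : β < δ) (hα : 1 - β < α) (hC : 0 ≤ C) (ht : 0 ≤ t)
    (hφ : Measurable φ) (hhm : Measurable h)
    (hA : ∀ᵐ s ∂volume.restrict (Ioc 0 t), |φ s| ≤ A) (hH : IntegrableOn H (Ioc 0 t))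
    (h1 : ∀ᵐ s ∂volume.restrict (Ioc 0 t), ∀ᵐ u ∂volume.restrict (Ioc 0 s),
      |φ s - φ u| ≤ H s * (s - u) ^ δ)
    (ht0 : h t = 0)
    (hh : ∀ u ∈ Icc 0 t, ∀ v ∈ Icc 0 t, |h u - h v| ≤ C * |u - v| ^ α) :
    IntervalIntegrable (fun s => fracDerivLeft β φ s * fracDerivRight (1 - β) t h s)
      volume 0 t := by
  rw [intervalIntegrable_iff_integrableOn_Ioc_of_le ht]
  refine Integrable.mono' ((intervalIntegrable_iff_integrableOn_Ioc_of_le ht).1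
    (intervalIntegrable_fracDeriv_bound hβ1 δ A (fracDerivRightBound (1 - β) α t C) ht
      hH hδ))
    ((measurable_fracDerivLeft β hφ).mul (measurable_fracDerivRight _ t hhm)).aestronglyMeasurable
    ?_
  filter_upwards [hA, h1, ae_restrict_Ioc_ne t] with s hsA hs1 hs
  exact abs_fracDeriv_mul_le hβ hβ1 hδ hα hC hs.1 hs.2 hsA hs1 ht0 hh

/-- Dominated convergence for the generalized Lebesgue--Stieltjes integral. -/
theorem tendsto_integral_fracDeriv_mul {β δ α t A C : ℝ} {φ h H : ℝ → ℝ} {φn hn : ℕ → ℝ → ℝ}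
    (hβ : 0 < β)
    (hβ1 : β < 1) (hδ : β < δ) (hα : 1 - β < α) (hC : 0 ≤ C) (ht : 0 ≤ t)
    (hφ : ∀ n, Measurable (φn n)) (hhm : ∀ n, Measurable (hn n))
    (hA : ∀ n, ∀ᵐ s ∂volume.restrict (Ioc 0 t), |φn n s| ≤ A) (hH : IntegrableOn H (Ioc 0 t))
    (h1 : ∀ n, ∀ᵐ s ∂volume.restrict (Ioc 0 t), ∀ᵐ u ∂volume.restrict (Ioc 0 s),
      |φn n s - φn n u| ≤ H s * (s - u) ^ δ)
    (hφlim : ∀ᵐ s ∂volume.restrict (Ioc 0 t), Tendsto (fun n => φn n s) atTop (𝓝 (φ s)))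
    (ht0 : ∀ n, hn n t = 0)
    (hh : ∀ n, ∀ u ∈ Icc 0 t, ∀ v ∈ Icc 0 t, |hn n u - hn n v| ≤ C * |u - v| ^ α)
    (hhlim : ∀ u ∈ Icc 0 t, Tendsto (fun n => hn n u) atTop (𝓝 (h u))) :
    Tendsto (fun n => ∫ s in (0 : ℝ)..t,
      fracDerivLeft β (φn n) s * fracDerivRight (1 - β) t (hn n) s) atTop
      (𝓝 (∫ s in (0 : ℝ)..t, fracDerivLeft β φ s * fracDerivRight (1 - β) t h s)) := by
  refine intervalIntegral.tendsto_integral_filter_of_dominated_convergence _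
    (Eventually.of_forall fun n => ?_) (Eventually.of_forall fun n => ?_)
    (intervalIntegrable_fracDeriv_bound hβ1 δ A (fracDerivRightBound (1 - β) α t C) ht
      hH hδ) ?_
  · exact ((measurable_fracDerivLeft β (hφ n)).mul
      (measurable_fracDerivRight _ t (hhm n))).aestronglyMeasurable
  · rw [uIoc_of_le ht, ← ae_restrict_iff' measurableSet_Ioc]
    filter_upwards [hA n, h1 n, ae_restrict_Ioc_ne t] with s hsA hs1 hs
    exact abs_fracDeriv_mul_le hβ hβ1 hδ hα hC hs.1 hs.2 hsA hs1 (ht0 n) (hh n)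
  · rw [uIoc_of_le ht, ← ae_restrict_iff' measurableSet_Ioc]
    filter_upwards [hφlim, ae_all_iff.2 h1, ae_restrict_Ioc_ne t] with s hlim hs1 hs
    refine (tendsto_fracDerivLeft hδ hs.1 hφ hlim ?_ hs1).mul
      (tendsto_fracDerivRight hα hs.1.le hs.2 hhm hhlim hh)
    exact ae_mono (Measure.restrict_mono (Ioc_subset_Ioc_right hs.2.le) le_rfl) hφlim

/-! ### Continuously differentiable functions -/

/-- The Beta integral `B(1 - β, β)` on an interval of arbitrary length; its value does not depend
on the length since the exponents add up to `-1`. -/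
theorem integral_rpow_mul_sub_rpow {β v : ℝ} (hβ : 0 < β) (hβ1 : β < 1) (hv : 0 < v) :
    ∫ s in (0 : ℝ)..v, s ^ (-β) * (v - s) ^ (β - 1) = Real.Gamma (1 - β) * Real.Gamma β := by
  have h := Complex.betaIntegral_scaled ((1 - β : ℝ) : ℂ) ((β : ℝ) : ℂ) hv
  rw [Complex.betaIntegral_eq_Gamma_mul_div _ _ (by simpa using hβ1) (by simpa using hβ),
    ← Complex.ofReal_add, sub_add_cancel, Complex.ofReal_one, sub_self, Complex.cpow_zero,
    Complex.Gamma_one, div_one, one_mul, Complex.Gamma_ofReal, Complex.Gamma_ofReal] at h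
  apply Complex.ofReal_injective
  rw [← intervalIntegral.integral_ofReal, Complex.ofReal_mul, ← h]
  refine intervalIntegral.integral_congr fun s hs => ?_
  rw [uIcc_of_le hv.le] at hs
  rw [Complex.ofReal_mul, Complex.ofReal_cpow hs.1, Complex.ofReal_cpow (by linarith [hs.2])]
  push_cast
  congr 2
  ring

theorem intervalIntegrable_rpow_mul_sub_rpow {β v : ℝ} (hβ : 0 < β) (hβ1 : β < 1) (hv : 0 < v) :
    IntervalIntegrable (fun s => s ^ (-β) * (v - s) ^ (β - 1)) volume 0 v := by
  -- a function that is not integrable has integral `0`, but this integral is positive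
  refine intervalIntegral.intervalIntegrable_of_integral_ne_zero ?_
  rw [integral_rpow_mul_sub_rpow hβ hβ1 hv]
  exact (mul_pos (Real.Gamma_pos_of_pos (by linarith)) (Real.Gamma_pos_of_pos hβ)).ne'

theorem integral_sub_rpow_mul_sub_rpow {β u v : ℝ} (hβ : 0 < β) (hβ1 : β < 1) (huv : u < v) :
    ∫ s in u..v, (s - u) ^ (-β) * (v - s) ^ (β - 1) = Real.Gamma (1 - β) * Real.Gamma β := by
  rw [← integral_rpow_mul_sub_rpow hβ hβ1 (sub_pos.2 huv)]
  have := intervalIntegral.integral_comp_sub_right (a := u) (b := v)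
    (fun x => x ^ (-β) * (v - u - x) ^ (β - 1)) u
  rw [sub_self] at this
  rw [← this]
  simp

theorem intervalIntegrable_sub_rpow_mul_sub_rpow {β u v : ℝ} (hβ : 0 < β) (hβ1 : β < 1)
    (huv : u < v) :
    IntervalIntegrable (fun s => (s - u) ^ (-β) * (v - s) ^ (β - 1)) volume u v := by
  refine intervalIntegral.intervalIntegrable_of_integral_ne_zero ?_
  rw [integral_sub_rpow_mul_sub_rpow hβ hβ1 huv]
  exact (mul_pos (Real.Gamma_pos_of_pos (by linarith)) (Real.Gamma_pos_of_pos hβ)).ne'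

/-- The triangle `0 < s < v ≤ t` in the plane. -/
def openTriangle (t : ℝ) : Set (ℝ × ℝ) := {p | 0 < p.1 ∧ p.1 < p.2 ∧ p.2 ≤ t}

theorem measurableSet_openTriangle (t : ℝ) : MeasurableSet (openTriangle t) :=
  (measurableSet_lt measurable_const measurable_fst).inter
    ((measurableSet_lt measurable_fst measurable_snd).inter
      (measurableSet_le measurable_snd measurable_const))

theorem indicator_openTriangle_left (t s : ℝ) (K : ℝ × ℝ → ℝ) :
    (fun v => (openTriangle t).indicator K (s, v)) =
      (Ioc 0 t).indicator (fun s => (Ioc s t).indicator fun v => K (s, v)) s := by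
  funext v
  by_cases hs : s ∈ Ioc 0 t
  · rw [indicator_of_mem hs]
    simp [indicator, openTriangle, hs.1]
  · rw [indicator_of_notMem hs, indicator_of_notMem]
    · rfl
    · exact fun h => hs ⟨h.1, h.2.1.le.trans h.2.2⟩

theorem indicator_openTriangle_right (t v : ℝ) (K : ℝ × ℝ → ℝ) :
    (fun s => (openTriangle t).indicator K (s, v)) =
      (Ioc 0 t).indicator (fun v => (Ioo 0 v).indicator fun s => K (s, v)) v := by
  funext s
  by_cases hv : v ∈ Ioc 0 t
  · rw [indicator_of_mem hv]
    simp [indicator, openTriangle, hv.2]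
  · rw [indicator_of_notMem hv, indicator_of_notMem]
    · rfl
    · exact fun h => hv ⟨h.1.trans h.2.1, h.2.2⟩

theorem integral_indicator_openTriangle_left (t : ℝ) (K : ℝ × ℝ → ℝ) :
    (fun s => ∫ v, (openTriangle t).indicator K (s, v)) =
      (Ioc 0 t).indicator (fun s => ∫ v in s..t, K (s, v)) := by
  funext s
  rw [indicator_openTriangle_left]
  by_cases hs : s ∈ Ioc 0 t
  · rw [indicator_of_mem hs, indicator_of_mem hs, integral_indicator measurableSet_Ioc,
      intervalIntegral.integral_of_le hs.2]
  · rw [indicator_of_notMem hs, indicator_of_notMem hs]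
    simp

theorem integral_indicator_openTriangle_right (t : ℝ) (K : ℝ × ℝ → ℝ) :
    (fun v => ∫ s, (openTriangle t).indicator K (s, v)) =
      (Ioc 0 t).indicator (fun v => ∫ s in (0 : ℝ)..v, K (s, v)) := by
  funext v
  rw [indicator_openTriangle_right]
  by_cases hv : v ∈ Ioc 0 t
  · rw [indicator_of_mem hv, indicator_of_mem hv, integral_indicator measurableSet_Ioo,
      intervalIntegral.integral_of_le hv.1.le, integral_Ioc_eq_integral_Ioo]
  · rw [indicator_of_notMem hv, indicator_of_notMem hv]
    simp

/-- Fubini's theorem on a triangle. -/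
theorem integral_triangle_swap {t : ℝ} (ht : 0 ≤ t) {K : ℝ × ℝ → ℝ}
    (hK : IntegrableOn K (openTriangle t)) :
    ∫ s in (0 : ℝ)..t, ∫ v in s..t, K (s, v) = ∫ v in (0 : ℝ)..t, ∫ s in (0 : ℝ)..v, K (s, v) := by
  have hK' := (integrable_indicator_iff (measurableSet_openTriangle t)).2 hK
  have h := integral_integral_swap (f := fun s v => (openTriangle t).indicator K (s, v)) hK'
  rw [integral_indicator_openTriangle_left] at h
  have h2 := integral_indicator_openTriangle_right t K
  rw [h2, integral_indicator measurableSet_Ioc, integral_indicator measurableSet_Ioc] at h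
  rw [intervalIntegral.integral_of_le ht, intervalIntegral.integral_of_le ht, h]

theorem integrableOn_triangle_rpow_mul_sub_rpow {β : ℝ} (hβ : 0 < β) (hβ1 : β < 1) (t : ℝ) :
    IntegrableOn (fun p : ℝ × ℝ => p.1 ^ (-β) * (p.2 - p.1) ^ (β - 1)) (openTriangle t) := by
  set K : ℝ × ℝ → ℝ := fun p => p.1 ^ (-β) * (p.2 - p.1) ^ (β - 1) with hKdef
  have hKm : Measurable K := by fun_prop
  rw [← integrable_indicator_iff (measurableSet_openTriangle t)]
  refine (integrable_prod_iff'
    (hKm.indicator (measurableSet_openTriangle t)).aestronglyMeasurable).2 ⟨?_, ?_⟩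
  · refine ae_of_all _ fun v => ?_
    rw [indicator_openTriangle_right]
    by_cases hv : v ∈ Ioc 0 t
    · rw [indicator_of_mem hv, integrable_indicator_iff measurableSet_Ioo]
      exact ((intervalIntegrable_iff_integrableOn_Ioo_of_le hv.1.le).1
        (intervalIntegrable_rpow_mul_sub_rpow hβ hβ1 hv.1))
    · rw [indicator_of_notMem hv]
      exact integrable_zero _ _ _
  · have hnorm : ∀ p, ‖(openTriangle t).indicator K p‖ = (openTriangle t).indicator K p := by
      intro p
      refine Real.norm_of_nonneg (indicator_nonneg (fun q hq => ?_) p)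
      exact mul_nonneg (Real.rpow_nonneg hq.1.le _)
        (Real.rpow_nonneg (sub_nonneg.2 hq.2.1.le) _)
    simp only [hnorm]
    rw [integral_indicator_openTriangle_right, integrable_indicator_iff measurableSet_Ioc]
    refine (integrableOn_const (C := Real.Gamma (1 - β) * Real.Gamma β)
      (by simp) enorm_ne_top).congr_fun (fun v hv => ?_) measurableSet_Ioc
    exact (integral_rpow_mul_sub_rpow hβ hβ1 hv.1).symm

theorem integrableOn_triangle_sub_rpow_mul_sub_rpow {β : ℝ} (hβ : 0 < β) (hβ1 : β < 1) (v : ℝ) :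
    IntegrableOn (fun p : ℝ × ℝ => (p.2 - p.1) ^ (-β) * (v - p.2) ^ (β - 1))
      (openTriangle v) := by
  set K : ℝ × ℝ → ℝ := fun p => (p.2 - p.1) ^ (-β) * (v - p.2) ^ (β - 1) with hKdef
  have hKm : Measurable K := by fun_prop
  rw [← integrable_indicator_iff (measurableSet_openTriangle v)]
  refine (integrable_prod_iff
    (hKm.indicator (measurableSet_openTriangle v)).aestronglyMeasurable).2 ⟨?_, ?_⟩
  · have hne : ∀ᵐ u ∂(volume : Measure ℝ), u ≠ v := by simp [ae_iff]
    filter_upwards [hne] with u huv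
    rw [indicator_openTriangle_left]
    by_cases hu : u ∈ Ioc 0 v
    · rw [indicator_of_mem hu, integrable_indicator_iff measurableSet_Ioc]
      exact ((intervalIntegrable_iff_integrableOn_Ioc_of_le hu.2).1
        (intervalIntegrable_sub_rpow_mul_sub_rpow hβ hβ1 (lt_of_le_of_ne hu.2 huv)))
    · rw [indicator_of_notMem hu]
      exact integrable_zero _ _ _
  · have hnorm : ∀ p, ‖(openTriangle v).indicator K p‖ = (openTriangle v).indicator K p := by
      intro p
      refine Real.norm_of_nonneg (indicator_nonneg (fun q hq => ?_) p)
      exact mul_nonneg (Real.rpow_nonneg (sub_nonneg.2 hq.2.1.le) _)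
        (Real.rpow_nonneg (sub_nonneg.2 hq.2.2) _)
    simp only [hnorm]
    rw [integral_indicator_openTriangle_left, integrable_indicator_iff measurableSet_Ioc]
    refine (integrableOn_const (μ := volume) (s := Ioc 0 v)
      (C := Real.Gamma (1 - β) * Real.Gamma β) (by simp) enorm_ne_top).congr_fun_ae ?_
    filter_upwards [ae_restrict_Ioc_ne v] with u hu
    exact (integral_sub_rpow_mul_sub_rpow hβ hβ1 hu.2).symm

/-- For `φ` of class `C¹` the Weyl form of the fractional derivative is the Riemann--Liouville
form, by an integration by parts. -/
theorem fracDerivLeft_of_contDiff {β s : ℝ} (hβ1 : β < 1) (hs : 0 < s) {φ : ℝ → ℝ}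
    (hφ : ContDiff ℝ 1 φ) :
    fracDerivLeft β φ s = 1 / Real.Gamma (1 - β) *
      (φ 0 * s ^ (-β) + ∫ u in (0 : ℝ)..s, deriv φ u * (s - u) ^ (-β)) := by
  have hd : Differentiable ℝ φ := hφ.differentiable (by norm_num)
  have hc' : Continuous (deriv φ) := hφ.continuous_deriv le_rfl
  -- the difference quotient at `s` extends continuously, which removes the singularity at `u = s`
  have hslope : Continuous (dslope φ s) := by
    rw [← continuousOn_univ, continuousOn_dslope univ_mem]
    exact ⟨hd.continuous.continuousOn, hd s⟩
  have hsl : ∀ u, φ s - φ u = dslope φ s u * (s - u) := by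
    intro u
    have := sub_smul_dslope φ s u
    rw [smul_eq_mul] at this
    linarith
  have hint : IntervalIntegrable (fun u => (s - u) ^ (-β)) volume 0 s :=
    intervalIntegrable_sub_rpow (by linarith) s
  have hi1 : IntervalIntegrable (fun u => deriv φ u * (s - u) ^ (-β)) volume 0 s :=
    hint.continuousOn_mul hc'.continuousOn
  have hi2 : IntervalIntegrable (fun u => (φ s - φ u) / (s - u) ^ (β + 1)) volume 0 s := by
    refine (hint.continuousOn_mul hslope.continuousOn).congr_ae ?_
    rw [uIoc_of_le hs.le]
    filter_upwards [ae_restrict_Ioc_ne s] with u hu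
    have hpos : 0 < s - u := by linarith [hu.2]
    rw [hsl u, Real.rpow_add hpos, Real.rpow_one, Real.rpow_neg hpos.le]
    field_simp
  have hP : ContinuousOn (fun u => (φ s - φ u) * (s - u) ^ (-β)) (Icc 0 s) := by
    have : Continuous fun u => dslope φ s u * (s - u) ^ (1 - β) :=
      hslope.mul ((continuous_const.sub continuous_id).rpow_const fun _ => Or.inr (by linarith))
    refine this.continuousOn.congr fun u hu => ?_
    simp only
    rw [hsl u]
    rcases hu.2.eq_or_lt with rfl | hlt
    · rw [sub_self, Real.zero_rpow (by linarith : 1 - β ≠ 0)]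
      simp
    · rw [sub_eq_add_neg 1 β, Real.rpow_add (sub_pos.2 hlt), Real.rpow_one]
      ring
  have hderiv : ∀ u ∈ Ioo 0 s, HasDerivAt (fun u => (φ s - φ u) * (s - u) ^ (-β))
      (β * ((φ s - φ u) / (s - u) ^ (β + 1)) - deriv φ u * (s - u) ^ (-β)) u := by
    intro u hu
    have hpos : 0 < s - u := by linarith [hu.2]
    have h1 : HasDerivAt (fun u => φ s - φ u) (-deriv φ u) u := (hd u).hasDerivAt.const_sub _
    have h2 : HasDerivAt (fun u => (s - u) ^ (-β)) (-1 * (-β) * (s - u) ^ (-β - 1)) u :=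
      ((hasDerivAt_id u).const_sub s).rpow_const (Or.inl hpos.ne')
    refine (h1.mul h2).congr_deriv ?_
    rw [show -β - 1 = -(β + 1) by ring, Real.rpow_neg hpos.le (β + 1)]
    ring
  have key := intervalIntegral.integral_eq_sub_of_hasDerivAt_of_le hs.le hP hderiv
    ((hi2.const_mul β).sub hi1)
  rw [intervalIntegral.integral_sub (hi2.const_mul β) hi1, intervalIntegral.integral_const_mul,
    sub_self, zero_mul, sub_zero, zero_sub] at key
  unfold fracDerivLeft
  congr 1
  rw [div_eq_mul_inv, ← Real.rpow_neg hs.le]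
  linarith

theorem fracDerivRight_of_contDiff {β s t : ℝ} (hβ : 0 < β) (hst : s < t) {g : ℝ → ℝ}
    (hg : ContDiff ℝ 1 g) :
    fracDerivRight (1 - β) t (fun u => g u - g t) s = -(1 / Real.Gamma β *
      ∫ v in s..t, deriv g v * (v - s) ^ (β - 1)) := by
  have hh : ContDiff ℝ 1 (fun r => g (t - r) - g t) :=
    (hg.comp (contDiff_const.sub contDiff_id)).sub contDiff_const
  rw [fracDerivRight_eq_fracDerivLeft, fracDerivLeft_of_contDiff (by linarith) (by linarith) hh,
    sub_zero, sub_self, zero_mul,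
    zero_add, sub_sub_cancel, ← mul_neg]
  congr 1
  have hd : Differentiable ℝ g := hg.differentiable (by norm_num)
  have hder : ∀ u, deriv (fun r => g (t - r) - g t) u = -deriv g (t - u) := by
    intro u
    have := ((hd (t - u)).hasDerivAt.scomp u ((hasDerivAt_id u).const_sub t)).sub_const (g t)
    simpa using this.deriv
  simp only [hder]
  have := intervalIntegral.integral_comp_sub_left (a := 0) (b := t - s)
    (fun v => deriv g v * (v - s) ^ (β - 1)) t
  rw [sub_sub_cancel, sub_zero] at this
  rw [← this, ← intervalIntegral.integral_neg]
  refine intervalIntegral.integral_congr fun u _ => ?_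
  rw [neg_sub, show t - s - u = t - u - s by ring, neg_mul]

theorem abs_integral_deriv_mul_sub_rpow_le {β s t L : ℝ} {ψ : ℝ → ℝ} (hβ1 : β < 1) (hs : 0 ≤ s)
    (hst : s ≤ t) (hL : ∀ u ∈ Icc 0 t, |ψ u| ≤ L) :
    |∫ u in (0 : ℝ)..s, ψ u * (s - u) ^ (-β)| ≤ L * (t ^ (1 - β) / (1 - β)) := by
  have hL0 : 0 ≤ L := (abs_nonneg _).trans (hL 0 ⟨le_rfl, hs.trans hst⟩)
  have h1 : 0 < 1 - β := by linarith
  have := integral_sub_rpow (r := -β) (by linarith) s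
  calc |∫ u in (0 : ℝ)..s, ψ u * (s - u) ^ (-β)|
      ≤ ∫ u in (0 : ℝ)..s, L * (s - u) ^ (-β) := by
        rw [← Real.norm_eq_abs]
        refine intervalIntegral.norm_integral_le_of_norm_le hs (ae_of_all _ fun u hu => ?_)
          ((intervalIntegrable_sub_rpow (by linarith) s).const_mul L)
        have hsu : 0 ≤ s - u := by linarith [hu.2]
        rw [norm_mul, Real.norm_eq_abs, Real.norm_of_nonneg (Real.rpow_nonneg hsu _)]
        exact mul_le_mul_of_nonneg_right (hL u ⟨hu.1.le, hu.2.trans hst⟩) (Real.rpow_nonneg hsu _)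
    _ = L * (s ^ (1 - β) / (1 - β)) := by
        rw [intervalIntegral.integral_const_mul, this, neg_add_eq_sub]
    _ ≤ _ := by gcongr

/-- Fractional integration of order `β` inverts `D^β` on `C¹` functions. -/
theorem integral_fracDeriv_mul_sub_rpow {β v : ℝ} (hβ : 0 < β) (hβ1 : β < 1) (hv : 0 < v)
    {φ : ℝ → ℝ} (hφ : ContDiff ℝ 1 φ) :
    ∫ s in (0 : ℝ)..v, (φ 0 * s ^ (-β) + ∫ u in (0 : ℝ)..s, deriv φ u * (s - u) ^ (-β)) *
      (v - s) ^ (β - 1) = Real.Gamma (1 - β) * Real.Gamma β * φ v := by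
  have hd : Differentiable ℝ φ := hφ.differentiable (by norm_num)
  have hc' : Continuous (deriv φ) := hφ.continuous_deriv le_rfl
  obtain ⟨L, hL⟩ := isCompact_Icc.exists_bound_of_continuousOn (s := Icc 0 v) hc'.continuousOn
  have hAm : Measurable fun s => ∫ u in (0 : ℝ)..s, deriv φ u * (s - u) ^ (-β) := by
    apply measurable_intervalIntegral_of_uncurry
    unfold Function.uncurry
    have := hc'.measurable
    fun_prop
  have hI1 := (intervalIntegrable_rpow_mul_sub_rpow hβ hβ1 hv).const_mul (φ 0)
  have hI2 : IntervalIntegrable (fun s => (∫ u in (0 : ℝ)..s, deriv φ u * (s - u) ^ (-β)) *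
      (v - s) ^ (β - 1)) volume 0 v := by
    rw [intervalIntegrable_iff_integrableOn_Ioc_of_le hv.le]
    refine Integrable.bdd_mul (c := L * (v ^ (1 - β) / (1 - β)))
      ((intervalIntegrable_iff_integrableOn_Ioc_of_le hv.le).1
        (intervalIntegrable_sub_rpow (by linarith) v)) hAm.aestronglyMeasurable ?_
    refine (ae_restrict_iff' measurableSet_Ioc).2 (ae_of_all _ fun s hs => ?_)
    exact abs_integral_deriv_mul_sub_rpow_le hβ1 hs.1.le hs.2 hL
  have hsplit : ∀ s, (φ 0 * s ^ (-β) + ∫ u in (0 : ℝ)..s, deriv φ u * (s - u) ^ (-β)) *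
      (v - s) ^ (β - 1) = φ 0 * (s ^ (-β) * (v - s) ^ (β - 1)) +
        (∫ u in (0 : ℝ)..s, deriv φ u * (s - u) ^ (-β)) * (v - s) ^ (β - 1) := fun s => by ring
  simp only [hsplit]
  rw [intervalIntegral.integral_add hI1 hI2, intervalIntegral.integral_const_mul,
    integral_rpow_mul_sub_rpow hβ hβ1 hv]
  have hK : IntegrableOn (fun p : ℝ × ℝ =>
      deriv φ p.1 * ((p.2 - p.1) ^ (-β) * (v - p.2) ^ (β - 1))) (openTriangle v) := by
    refine Integrable.bdd_mul (c := L) (integrableOn_triangle_sub_rpow_mul_sub_rpow hβ hβ1 v)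
      (hc'.comp continuous_fst).measurable.aestronglyMeasurable ?_
    refine (ae_restrict_iff' (measurableSet_openTriangle v)).2 (ae_of_all _ fun p hp => ?_)
    exact hL _ ⟨hp.1.le, hp.2.1.le.trans hp.2.2⟩
  have hswap := integral_triangle_swap hv.le hK
  have e1 : ∫ s in (0 : ℝ)..v, (∫ u in (0 : ℝ)..s, deriv φ u * (s - u) ^ (-β)) *
      (v - s) ^ (β - 1) = ∫ u in (0 : ℝ)..v, deriv φ u *
        (Real.Gamma (1 - β) * Real.Gamma β) := by
    simp only [← intervalIntegral.integral_mul_const, mul_assoc]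
    rw [← hswap]
    refine intervalIntegral.integral_congr_ae ?_
    rw [uIoc_of_le hv.le, ← ae_restrict_iff' measurableSet_Ioc]
    filter_upwards [ae_restrict_Ioc_ne v] with u hu
    rw [intervalIntegral.integral_const_mul, integral_sub_rpow_mul_sub_rpow hβ hβ1 hu.2]
  rw [e1, intervalIntegral.integral_mul_const,
    intervalIntegral.integral_deriv_eq_sub (fun x _ => hd x) (hc'.intervalIntegrable _ _)]
  ring

/-- Fractional integration by parts: for `C¹` functions the generalized Lebesgue--Stieltjes
integral is the Riemann--Stieltjes integral. -/
theorem integral_fracDeriv_mul_of_contDiff {β t : ℝ} (hβ : 0 < β) (hβ1 : β < 1) (ht : 0 < t)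
    {φ g : ℝ → ℝ} (hφ : ContDiff ℝ 1 φ) (hg : ContDiff ℝ 1 g) :
    ∫ s in (0 : ℝ)..t, fracDerivLeft β φ s * fracDerivRight (1 - β) t (fun u => g u - g t) s
      = -∫ v in (0 : ℝ)..t, φ v * deriv g v := by
  have hφc' : Continuous (deriv φ) := hφ.continuous_deriv le_rfl
  have hgc' : Continuous (deriv g) := hg.continuous_deriv le_rfl
  obtain ⟨L, hL⟩ := isCompact_Icc.exists_bound_of_continuousOn (s := Icc 0 t) hφc'.continuousOn
  obtain ⟨L', hL'⟩ := isCompact_Icc.exists_bound_of_continuousOn (s := Icc 0 t) hgc'.continuousOn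
  have hL0 : 0 ≤ L := (norm_nonneg _).trans (hL 0 ⟨le_rfl, ht.le⟩)
  set A : ℝ → ℝ := fun s => φ 0 * s ^ (-β) + ∫ u in (0 : ℝ)..s, deriv φ u * (s - u) ^ (-β)
    with hA
  have hAm : Measurable A := by
    have : Measurable fun s => ∫ u in (0 : ℝ)..s, deriv φ u * (s - u) ^ (-β) := by
      apply measurable_intervalIntegral_of_uncurry
      unfold Function.uncurry
      have := hφc'.measurable
      fun_prop
    fun_prop
  set c := Real.Gamma (1 - β) * Real.Gamma β with hc
  have hG1 : 0 < Real.Gamma (1 - β) := Real.Gamma_pos_of_pos (by linarith)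
  have hG2 : 0 < Real.Gamma β := Real.Gamma_pos_of_pos hβ
  -- `A s = O(s ^ (-β))` on `(0, t]`.
  have hAle : ∀ s ∈ Ioc 0 t, |A s * s ^ β| ≤
      |φ 0| + L * (t ^ (1 - β) / (1 - β)) * t ^ β := by
    intro s hs
    have h0 : s ^ (-β) * s ^ β = 1 := by
      rw [← Real.rpow_add hs.1, neg_add_cancel, Real.rpow_zero]
    have h1 : 0 < 1 - β := by linarith
    have h2 := abs_integral_deriv_mul_sub_rpow_le hβ1 hs.1.le hs.2 hL
    have h3 : s ^ β ≤ t ^ β := Real.rpow_le_rpow hs.1.le hs.2 hβ.le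
    have h4 : 0 ≤ s ^ β := Real.rpow_nonneg hs.1.le _
    rw [hA]
    simp only
    rw [add_mul, mul_assoc, h0, mul_one]
    refine (abs_add_le _ _).trans ?_
    gcongr
    rw [abs_mul, abs_of_nonneg h4]
    exact mul_le_mul h2 h3 h4 (by positivity)
  have hK : IntegrableOn (fun p : ℝ × ℝ => A p.1 * (deriv g p.2 * (p.2 - p.1) ^ (β - 1)))
      (openTriangle t) := by
    have hb : IntegrableOn (fun p : ℝ × ℝ => (A p.1 * p.1 ^ β * deriv g p.2) *
        (p.1 ^ (-β) * (p.2 - p.1) ^ (β - 1))) (openTriangle t) := by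
      refine Integrable.bdd_mul (c := (|φ 0| + L * (t ^ (1 - β) / (1 - β)) * t ^ β) * L')
        (integrableOn_triangle_rpow_mul_sub_rpow hβ hβ1 t) ?_ ?_
      · have := hgc'.measurable
        exact Measurable.aestronglyMeasurable (by fun_prop)
      · refine (ae_restrict_iff' (measurableSet_openTriangle t)).2 (ae_of_all _ fun p hp => ?_)
        rw [norm_mul]
        have h1 := hAle p.1 ⟨hp.1, hp.2.1.le.trans hp.2.2⟩
        exact mul_le_mul h1 (hL' p.2 ⟨(hp.1.trans hp.2.1).le, hp.2.2⟩) (norm_nonneg _)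
          ((abs_nonneg _).trans h1)
    refine hb.congr_fun (fun p hp => ?_) (measurableSet_openTriangle t)
    have h0 : p.1 ^ (-β) * p.1 ^ β = 1 := by
      rw [← Real.rpow_add hp.1, neg_add_cancel, Real.rpow_zero]
    calc A p.1 * p.1 ^ β * deriv g p.2 * (p.1 ^ (-β) * (p.2 - p.1) ^ (β - 1))
        = A p.1 * (deriv g p.2 * (p.2 - p.1) ^ (β - 1)) * (p.1 ^ (-β) * p.1 ^ β) := by ring
      _ = _ := by rw [h0, mul_one]
  have hswap := integral_triangle_swap ht.le hK
  have e1 : ∫ s in (0 : ℝ)..t,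
      fracDerivLeft β φ s * fracDerivRight (1 - β) t (fun u => g u - g t) s
      = ∫ s in (0 : ℝ)..t, -(1 / c) * ∫ v in s..t, A s * (deriv g v * (v - s) ^ (β - 1)) := by
    refine intervalIntegral.integral_congr_ae ?_
    rw [uIoc_of_le ht.le, ← ae_restrict_iff' measurableSet_Ioc]
    filter_upwards [ae_restrict_Ioc_ne t] with s hs
    rw [fracDerivLeft_of_contDiff hβ1 hs.1 hφ, fracDerivRight_of_contDiff hβ hs.2 hg,
      intervalIntegral.integral_const_mul, hc]
    field_simp
    ring
  have e2 : ∫ v in (0 : ℝ)..t, ∫ s in (0 : ℝ)..v, A s * (deriv g v * (v - s) ^ (β - 1))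
      = ∫ v in (0 : ℝ)..t, c * (φ v * deriv g v) := by
    refine intervalIntegral.integral_congr_ae (ae_of_all _ fun v hv => ?_)
    rw [uIoc_of_le ht.le] at hv
    have := integral_fracDeriv_mul_sub_rpow hβ hβ1 hv.1 hφ
    calc ∫ s in (0 : ℝ)..v, A s * (deriv g v * (v - s) ^ (β - 1))
        = ∫ s in (0 : ℝ)..v, deriv g v * (A s * (v - s) ^ (β - 1)) := by
          refine intervalIntegral.integral_congr fun s _ => ?_
          ring
      _ = _ := by
          rw [intervalIntegral.integral_const_mul, this]
          ring
  have hc0 : c ≠ 0 := (mul_pos hG1 hG2).ne'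
  rw [e1, intervalIntegral.integral_const_mul, hswap, e2, intervalIntegral.integral_const_mul]
  field_simp

/-! ### Integrands of class `C¹` along Hölder paths -/

/-- The average of `g` over `[s, s + 1 / (n + 1)]`: a `C¹` approximation of a continuous function
that preserves every modulus of continuity. -/
noncomputable def forwardAverage (g : ℝ → ℝ) (n : ℕ) (s : ℝ) : ℝ :=
  ∫ r in (0 : ℝ)..1, g (s + r / ((n : ℝ) + 1))

theorem contDiff_forwardAverage {g : ℝ → ℝ} (hg : Continuous g) (n : ℕ) :
    ContDiff ℝ 1 (forwardAverage g n) := by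
  have hn : (n : ℝ) + 1 ≠ 0 := by positivity
  set G : ℝ → ℝ := fun x => ∫ y in (0 : ℝ)..x, g y with hG
  have hGd : ∀ x, HasDerivAt G (g x) x := fun x =>
    intervalIntegral.integral_hasDerivAt_right (hg.intervalIntegrable _ _)
      (hg.stronglyMeasurableAtFilter _ _) hg.continuousAt
  have hGc : ContDiff ℝ 1 G := by
    rw [contDiff_one_iff_deriv]
    refine ⟨fun x => (hGd x).differentiableAt, ?_⟩
    rwa [show deriv G = g from funext fun x => (hGd x).deriv]
  have heq : forwardAverage g n = fun s => ((n : ℝ) + 1) * (G (s + 1 / ((n : ℝ) + 1)) - G s) := by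
    funext s
    unfold forwardAverage
    rw [intervalIntegral.integral_comp_add_div g hn, zero_div, add_zero, smul_eq_mul, hG]
    simp only
    rw [intervalIntegral.integral_interval_sub_left (hg.intervalIntegrable _ _)
      (hg.intervalIntegrable _ _)]
  rw [heq]
  exact contDiff_const.mul ((hGc.comp (contDiff_id.add contDiff_const)).sub hGc)

theorem abs_forwardAverage_sub_le {g : ℝ → ℝ} (hg : Continuous g) {C α : ℝ}
    (hC : ∀ x y, |g x - g y| ≤ C * |x - y| ^ α) (n : ℕ) (s u : ℝ) :
    |forwardAverage g n s - forwardAverage g n u| ≤ C * |s - u| ^ α := by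
  unfold forwardAverage
  rw [← intervalIntegral.integral_sub
    (Continuous.intervalIntegrable (by fun_prop) _ _)
    (Continuous.intervalIntegrable (by fun_prop) _ _)]
  have := intervalIntegral.norm_integral_le_of_norm_le_const (a := 0) (b := 1)
    (f := fun r => g (s + r / ((n : ℝ) + 1)) - g (u + r / ((n : ℝ) + 1)))
    (C := C * |s - u| ^ α) fun r _ => by
      have := hC (s + r / ((n : ℝ) + 1)) (u + r / ((n : ℝ) + 1))
      rwa [add_sub_add_right_eq_sub] at this
  simpa using this

theorem tendsto_forwardAverage {g : ℝ → ℝ} (hg : Continuous g) (s : ℝ) :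
    Tendsto (fun n => forwardAverage g n s) atTop (𝓝 (g s)) := by
  have h1 : g s = ∫ _r in (0 : ℝ)..1, g s := by simp
  obtain ⟨B, hB⟩ := isCompact_Icc.exists_bound_of_continuousOn (s := Icc s (s + 1))
    hg.continuousOn
  rw [h1]
  refine intervalIntegral.tendsto_integral_filter_of_dominated_convergence (fun _ => B)
    (Eventually.of_forall fun n => (Continuous.aestronglyMeasurable (by fun_prop)))
    (Eventually.of_forall fun n => ae_of_all _ fun r hr => ?_) (by simp)
    (ae_of_all _ fun r _ => ?_)
  · rw [uIoc_of_le zero_le_one] at hr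
    have hn : (1 : ℝ) ≤ (n : ℝ) + 1 := by
      have : (0 : ℝ) ≤ n := Nat.cast_nonneg n
      linarith
    refine hB _ ⟨by have := div_nonneg hr.1.le (zero_le_one.trans hn); linarith, ?_⟩
    have : r / ((n : ℝ) + 1) ≤ 1 := (div_le_one (by linarith)).2 (hr.2.trans hn)
    linarith
  · have h2 : Tendsto (fun n : ℕ => s + r / ((n : ℝ) + 1)) atTop (𝓝 (s + 0)) :=
      tendsto_const_nhds.add
        (tendsto_const_nhds.div_atTop (tendsto_natCast_atTop_atTop.atTop_add tendsto_const_nhds))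
    rw [add_zero] at h2
    exact (hg.tendsto s).comp h2

/-- The chain rule for the generalized Lebesgue--Stieltjes integral along a Hölder continuous
function `g`, with a `C¹` integrand `F`. -/
theorem integral_fracDeriv_comp_mul {β α t C K L : ℝ} {F g : ℝ → ℝ} (hβ : 0 < β) (hβ1 : β < 1)
    (hαβ : β < α) (hα : 1 - β < α) (ht : 0 ≤ t) (hC : 0 ≤ C) (hF : ContDiff ℝ 1 F)
    (hK : ∀ x, |F x| ≤ K) (hL : ∀ x y, |F x - F y| ≤ L * |x - y|)
    (hg : Continuous g) (hgC : ∀ x y, |g x - g y| ≤ C * |x - y| ^ α) :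
    ∫ s in (0 : ℝ)..t, fracDerivLeft β (fun u => F (g u)) s *
      fracDerivRight (1 - β) t (fun u => g u - g t) s = -∫ x in g 0..g t, F x := by
  rcases ht.eq_or_lt with rfl | ht'
  · simp
  have hL0 : 0 ≤ L := by
    have := (abs_nonneg _).trans (hL 1 0)
    simpa using this
  have hFc : Continuous F := hF.continuous
  have hgn := contDiff_forwardAverage hg
  have hcont : ∀ n, Continuous (forwardAverage g n) := fun n => (hgn n).continuous
  have h1 : Tendsto (fun n => ∫ s in (0 : ℝ)..t,
      fracDerivLeft β (fun u => F (forwardAverage g n u)) s *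
      fracDerivRight (1 - β) t (fun u => forwardAverage g n u - forwardAverage g n t) s) atTop
      (𝓝 (∫ s in (0 : ℝ)..t, fracDerivLeft β (fun u => F (g u)) s *
      fracDerivRight (1 - β) t (fun u => g u - g t) s)) := by
    refine tendsto_integral_fracDeriv_mul (δ := α) (α := α) (A := K) (C := C)
      (H := fun _ => L * C) hβ hβ1 hαβ hα hC ht (fun n => (hFc.comp (hcont n)).measurable)
      (fun n => ((hcont n).sub continuous_const).measurable)
      (fun n => ae_of_all _ fun s => hK _) (integrableOn_const (by simp) enorm_ne_top)
      (fun n => ae_of_all _ fun s => ?_) (ae_of_all _ fun s => ?_) (fun n => sub_self _)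
      (fun n u _ v _ => ?_) fun u _ => ?_
    · refine (ae_restrict_iff' measurableSet_Ioc).2 (ae_of_all _ fun u hu => ?_)
      have := abs_forwardAverage_sub_le hg hgC n s u
      rw [abs_of_nonneg (by linarith [hu.2] : 0 ≤ s - u)] at this
      refine (hL _ _).trans ?_
      rw [mul_assoc]
      exact mul_le_mul_of_nonneg_left this hL0
    · exact (hFc.tendsto _).comp (tendsto_forwardAverage hg s)
    · rw [sub_sub_sub_cancel_right]
      exact abs_forwardAverage_sub_le hg hgC n u v
    · exact (tendsto_forwardAverage hg u).sub (tendsto_forwardAverage hg t)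
  have h2 : ∀ n, ∫ s in (0 : ℝ)..t,
      fracDerivLeft β (fun u => F (forwardAverage g n u)) s *
      fracDerivRight (1 - β) t (fun u => forwardAverage g n u - forwardAverage g n t) s
      = -∫ x in forwardAverage g n 0..forwardAverage g n t, F x := by
    intro n
    refine (integral_fracDeriv_mul_of_contDiff hβ hβ1 ht' (hF.comp (hgn n)) (hgn n)).trans ?_
    congr 1
    exact intervalIntegral.integral_comp_mul_deriv
      (fun x _ => ((hgn n).differentiable (by norm_num) x).hasDerivAt)
      ((hgn n).continuous_deriv le_rfl).continuousOn hFc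
  have hprim : Continuous fun x => ∫ y in (0 : ℝ)..x, F y :=
    intervalIntegral.continuous_primitive (fun a b => hFc.intervalIntegrable a b) 0
  have hdiff : ∀ a b, ∫ x in a..b, F x = (∫ y in (0 : ℝ)..b, F y) - ∫ y in (0 : ℝ)..a, F y :=
    fun a b => (intervalIntegral.integral_interval_sub_left (hFc.intervalIntegrable _ _)
      (hFc.intervalIntegrable _ _)).symm
  have h3 : Tendsto (fun n => -∫ x in forwardAverage g n 0..forwardAverage g n t, F x) atTop
      (𝓝 (-∫ x in g 0..g t, F x)) := by
    simp only [hdiff (forwardAverage g _ _), hdiff (g 0)]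
    exact (((hprim.tendsto _).comp (tendsto_forwardAverage hg t)).sub
      ((hprim.tendsto _).comp (tendsto_forwardAverage hg 0))).neg
  simp only [h2] at h1
  exact tendsto_nhds_unique h1 h3

/-! ### Smooth approximation of functions of bounded variation -/

/-- `F n` are `C¹` functions that converge to `p` on `[-M, M]`, off a null set, and satisfy a
fractional pointwise Lipschitz bound `|F n x - F n y| ≤ |x - y| ^ γ * H x` with one function `H`
that is integrable on `[-M, M]`. Convergence is required wherever `H` is finite. -/
structure IsFracApprox (γ M : ℝ) (p : ℝ → ℝ) (H : ℝ → ℝ≥0∞) (F : ℕ → ℝ → ℝ) : Prop where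
  measurable : Measurable H
  lintegral_lt_top : ∫⁻ x in Icc (-M) M, H x < ∞
  contDiff : ∀ n, ContDiff ℝ 1 (F n)
  bounded : ∃ K, ∀ n x, |F n x| ≤ K
  lipschitz : ∀ n, ∃ L, ∀ x y, |F n x - F n y| ≤ L * |x - y|
  enorm_sub_le : ∀ n x y, ‖F n x - F n y‖ₑ ≤ ‖x - y‖ₑ ^ γ * H x
  tendsto : ∀ x ∈ Icc (-M) M, H x < ∞ → Tendsto (fun n => F n x) atTop (𝓝 (p x))

theorem IsFracApprox.sub {γ M : ℝ} {p q : ℝ → ℝ} {H H' : ℝ → ℝ≥0∞} {F F' : ℕ → ℝ → ℝ}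
    (h : IsFracApprox γ M p H F) (h' : IsFracApprox γ M q H' F') :
    IsFracApprox γ M (p - q) (H + H') (fun n => F n - F' n) where
  measurable := h.measurable.add h'.measurable
  lintegral_lt_top := by
    simp only [Pi.add_apply]
    rw [lintegral_add_left h.measurable]
    exact ENNReal.add_lt_top.2 ⟨h.lintegral_lt_top, h'.lintegral_lt_top⟩
  contDiff n := (h.contDiff n).sub (h'.contDiff n)
  bounded := by
    obtain ⟨K, hK⟩ := h.bounded
    obtain ⟨K', hK'⟩ := h'.bounded
    exact ⟨K + K', fun n x => (abs_sub _ _).trans (add_le_add (hK n x) (hK' n x))⟩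
  lipschitz n := by
    obtain ⟨K, hK⟩ := h.lipschitz n
    obtain ⟨K', hK'⟩ := h'.lipschitz n
    refine ⟨K + K', fun x y => ?_⟩
    rw [Pi.sub_apply, Pi.sub_apply, sub_sub_sub_comm, add_mul]
    exact (abs_sub _ _).trans (add_le_add (hK x y) (hK' x y))
  enorm_sub_le n x y := by
    rw [Pi.sub_apply, Pi.sub_apply, sub_sub_sub_comm, Pi.add_apply, mul_add]
    exact (_root_.enorm_sub_le).trans (add_le_add (h.enorm_sub_le n x y) (h'.enorm_sub_le n x y))
  tendsto x hx hlt := by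
    rw [Pi.add_apply, ENNReal.add_lt_top] at hlt
    exact (h.tendsto x hx hlt.1).sub (h'.tendsto x hx hlt.2)

/-- A smooth transition function, with limits `0` at `-∞` and `1` at `+∞`. -/
noncomputable def arctanStep (z : ℝ) : ℝ := 1 / 2 + Real.arctan z / Real.pi

theorem continuous_arctanStep : Continuous arctanStep :=
  continuous_const.add (Real.continuous_arctan.div_const _)

theorem hasDerivAt_arctanStep (z : ℝ) :
    HasDerivAt arctanStep (1 / (1 + z ^ 2) / Real.pi) z :=
  ((Real.hasDerivAt_arctan z).div_const _).const_add _

theorem arctanStep_mem_Icc (z : ℝ) : arctanStep z ∈ Icc 0 1 := by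
  unfold arctanStep
  have hpi := Real.pi_pos
  have h1 := Real.arctan_lt_pi_div_two z
  have h2 := Real.neg_pi_div_two_lt_arctan z
  constructor
  · have : -(1 / 2) ≤ Real.arctan z / Real.pi := by
      rw [le_div_iff₀ hpi]
      linarith
    linarith
  · have : Real.arctan z / Real.pi ≤ 1 / 2 := by
      rw [div_le_iff₀ hpi]
      linarith
    linarith

theorem abs_arctanStep_sub_le_one (z w : ℝ) : |arctanStep z - arctanStep w| ≤ 1 := by
  have h1 := arctanStep_mem_Icc z
  have h2 := arctanStep_mem_Icc w
  rw [abs_le]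
  constructor <;> linarith [h1.1, h1.2, h2.1, h2.2]

theorem abs_deriv_arctanStep_le (z : ℝ) : |1 / (1 + z ^ 2) / Real.pi| ≤ 1 / (1 + z ^ 2) := by
  have hpi : 1 ≤ Real.pi := by linarith [Real.pi_gt_three]
  rw [abs_of_nonneg (by positivity)]
  exact div_le_self (by positivity) hpi

theorem abs_arctanStep_sub_le (z w : ℝ) : |arctanStep z - arctanStep w| ≤ |z - w| := by
  have := convex_univ.norm_image_sub_le_of_norm_hasDerivWithin_le (f := arctanStep) (C := 1)
    (f' := fun z => 1 / (1 + z ^ 2) / Real.pi) (x := w) (y := z)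
    (fun x _ => (hasDerivAt_arctanStep x).hasDerivWithinAt)
    (fun x _ => (abs_deriv_arctanStep_le x).trans
      ((div_le_one (by positivity)).2 (by nlinarith [sq_nonneg x]))) (mem_univ _) (mem_univ _)
  simpa using this

/-- The scale-invariant Lipschitz bound behind the uniform control of the rescaled steps. -/
theorem abs_arctanStep_sub_mul_abs_le (z w : ℝ) :
    |arctanStep z - arctanStep w| * |z| ≤ 2 * |z - w| := by
  rcases le_or_gt |z| (2 * |z - w|) with h | h
  · calc |arctanStep z - arctanStep w| * |z| ≤ 1 * |z| :=
          mul_le_mul_of_nonneg_right (abs_arctanStep_sub_le_one z w) (abs_nonneg z)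
      _ ≤ _ := by rwa [one_mul]
  · have hz : 0 < |z| := by linarith [abs_nonneg (z - w)]
    -- between `w` and `z` all points have absolute value at least `|z| / 2`
    have hseg : ∀ x ∈ uIcc w z, 1 / (1 + x ^ 2) ≤ 1 / |z| := by
      intro x hx
      have h1 : |x - z| ≤ |z - w| := by
        have := abs_sub_right_of_mem_uIcc hx
        rwa [abs_sub_comm z x] at this
      have h2 : |z| / 2 ≤ |x| := by
        have := abs_sub_abs_le_abs_sub z x
        rw [abs_sub_comm z x] at this
        linarith
      refine one_div_le_one_div_of_le hz ?_
      rw [← sq_abs x]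
      nlinarith [sq_nonneg (|z| / 2 - 1), abs_nonneg z, mul_self_le_mul_self (by positivity) h2]
    have := (convex_uIcc w z).norm_image_sub_le_of_norm_hasDerivWithin_le (f := arctanStep)
      (f' := fun z => 1 / (1 + z ^ 2) / Real.pi) (x := w) (y := z)
      (fun x _ => (hasDerivAt_arctanStep x).hasDerivWithinAt)
      (fun x hx => (abs_deriv_arctanStep_le x).trans (hseg x hx)) left_mem_uIcc right_mem_uIcc
    rw [Real.norm_eq_abs, Real.norm_eq_abs] at this
    calc |arctanStep z - arctanStep w| * |z| ≤ 1 / |z| * |z - w| * |z| :=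
          mul_le_mul_of_nonneg_right this hz.le
      _ = |z - w| := by field_simp
      _ ≤ _ := by linarith [abs_nonneg (z - w)]

theorem enorm_arctanStep_sub_le {γ : ℝ} (hγ : 0 < γ) (hγ1 : γ < 1) {m : ℝ} (hm : 0 < m)
    (x y a : ℝ) :
    ‖arctanStep (m * (x - a)) - arctanStep (m * (y - a))‖ₑ ≤
      ‖x - y‖ₑ ^ γ * (2 * ‖x - a‖ₑ ^ (-γ)) := by
  rcases eq_or_ne x y with rfl | hxy
  · simp
  have hxy' : 0 < |x - y| := abs_pos.2 (sub_ne_zero.2 hxy)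
  rcases eq_or_ne x a with rfl | hxa
  · rw [sub_self x, enorm_zero, ENNReal.zero_rpow_of_neg (by linarith), ENNReal.mul_top (by simp),
      ENNReal.mul_top]
    · exact le_top
    · refine (ENNReal.rpow_pos ?_ enorm_ne_top).ne'
      rw [Real.enorm_eq_ofReal_abs]
      exact ENNReal.ofReal_pos.2 hxy'
  have hxa' : 0 < |x - a| := abs_pos.2 (sub_ne_zero.2 hxa)
  have hΔ1 := abs_arctanStep_sub_le_one (m * (x - a)) (m * (y - a))
  have hΔ2 := abs_arctanStep_sub_mul_abs_le (m * (x - a)) (m * (y - a))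
  rw [← mul_sub, sub_sub_sub_cancel_right, abs_mul, abs_mul, abs_of_pos hm] at hΔ2
  set Δ := arctanStep (m * (x - a)) - arctanStep (m * (y - a))
  have hΔ3 : |Δ| * |x - a| ≤ 2 * |x - y| := by
    refine le_of_mul_le_mul_left ?_ hm
    linarith
  have key : |Δ| ≤ |x - y| ^ γ * (2 * |x - a| ^ (-γ)) := by
    rw [Real.rpow_neg hxa'.le, ← div_eq_mul_inv, mul_div_assoc', mul_comm, mul_div_assoc,
      ← Real.div_rpow hxy'.le hxa'.le]
    have hr : 0 < |x - y| / |x - a| := by positivity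
    -- a number that is at most `2 * min 1 r` is at most `2 * r ^ γ`
    rcases le_or_gt 1 (|x - y| / |x - a|) with h | h
    · have := Real.one_le_rpow h hγ.le
      linarith
    · have h1 : |x - y| / |x - a| ≤ (|x - y| / |x - a|) ^ γ := by
        have := Real.rpow_le_rpow_of_exponent_ge hr h.le hγ1.le
        rwa [Real.rpow_one] at this
      have h2 : |Δ| ≤ 2 * (|x - y| / |x - a|) := by
        rw [mul_div_assoc', le_div_iff₀ hxa']
        exact hΔ3
      linarith
  rw [Real.enorm_eq_ofReal_abs, Real.enorm_eq_ofReal_abs, Real.enorm_eq_ofReal_abs,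
    ENNReal.ofReal_rpow_of_pos hxy', ENNReal.ofReal_rpow_of_pos hxa',
    ← ENNReal.ofReal_ofNat 2, ← ENNReal.ofReal_mul (by norm_num),
    ← ENNReal.ofReal_mul (by positivity)]
  exact ENNReal.ofReal_le_ofReal key

theorem tendsto_arctanStep_mul {z : ℝ} (hz : z ≠ 0) :
    Tendsto (fun n : ℕ => arctanStep (((n : ℝ) + 1) * z)) atTop
      (𝓝 (if 0 < z then 1 else 0)) := by
  have hn : Tendsto (fun n : ℕ => (n : ℝ) + 1) atTop atTop :=
    tendsto_natCast_atTop_atTop.atTop_add tendsto_const_nhds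
  have hpi := Real.pi_ne_zero
  unfold arctanStep
  split_ifs with h
  · have h1 := (tendsto_nhds_of_tendsto_nhdsWithin Real.tendsto_arctan_atTop).comp
      (hn.atTop_mul_const h)
    have h2 := (h1.div_const Real.pi).const_add (1 / 2)
    rwa [show 1 / 2 + Real.pi / 2 / Real.pi = 1 by field_simp; norm_num] at h2
  · have hz' : z < 0 := lt_of_le_of_ne (not_lt.1 h) hz
    have h1 := (tendsto_nhds_of_tendsto_nhdsWithin Real.tendsto_arctan_atBot).comp
      (hn.atTop_mul_const_of_neg hz')
    have h2 := (h1.div_const Real.pi).const_add (1 / 2)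
    rwa [show 1 / 2 + -(Real.pi / 2) / Real.pi = 0 by field_simp; norm_num] at h2

/-- The convolution of the rescaled step `z ↦ arctanStep (m * z)` with a measure. -/
noncomputable def arctanStepConv (μ : Measure ℝ) (m x : ℝ) : ℝ :=
  ∫ a, arctanStep (m * (x - a)) ∂μ

section

variable (μ : Measure ℝ) [IsFiniteMeasure μ]

theorem integrable_arctanStep (m x : ℝ) : Integrable (fun a => arctanStep (m * (x - a))) μ := by
  refine (integrable_const (1 : ℝ)).mono' (Continuous.aestronglyMeasurable
    (continuous_arctanStep.comp (by fun_prop))) (ae_of_all _ fun a => ?_)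
  have := arctanStep_mem_Icc (m * (x - a))
  rw [Real.norm_of_nonneg this.1]
  exact this.2

theorem contDiff_arctanStepConv (m : ℝ) : ContDiff ℝ 1 (arctanStepConv μ m) := by
  obtain ⟨d, hdc, hd1, hdd⟩ : ∃ d : ℝ → ℝ, Continuous d ∧ (∀ z, |d z| ≤ 1) ∧
      ∀ z, HasDerivAt arctanStep (d z) z := by
    refine ⟨_, ?_, fun z => (abs_deriv_arctanStep_le z).trans
      ((div_le_one (by positivity)).2 (by nlinarith [sq_nonneg z])), hasDerivAt_arctanStep⟩
    have : ∀ z : ℝ, 1 + z ^ 2 ≠ 0 := fun z => by positivity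
    exact (continuous_const.div (by fun_prop) this).div_const _
  have hd : ∀ x a, HasDerivAt (fun x => arctanStep (m * (x - a))) (d (m * (x - a)) * m) x := by
    intro x a
    have h1 : HasDerivAt (fun x => m * (x - a)) m x := by
      simpa using ((hasDerivAt_id x).sub_const a).const_mul m
    exact (hdd _).comp x h1
  have hb : ∀ x a, ‖d (m * (x - a)) * m‖ ≤ |m| := by
    intro x a
    rw [norm_mul]
    exact mul_le_of_le_one_left (abs_nonneg m) (hd1 _)
  have hderiv : ∀ x, HasDerivAt (arctanStepConv μ m) (∫ a, d (m * (x - a)) * m ∂μ) x := by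
    intro x
    refine (hasDerivAt_integral_of_dominated_loc_of_deriv_le (s := univ) (bound := fun _ => |m|)
      univ_mem (Eventually.of_forall fun x => (integrable_arctanStep μ m x).1)
      (integrable_arctanStep μ m x) ?_ (ae_of_all _ fun a x _ => hb x a) (integrable_const _)
      (ae_of_all _ fun a x _ => hd x a)).2
    exact Continuous.aestronglyMeasurable (by fun_prop)
  rw [contDiff_one_iff_deriv]
  refine ⟨fun x => (hderiv x).differentiableAt, ?_⟩
  rw [show deriv (arctanStepConv μ m) = fun x => ∫ a, d (m * (x - a)) * m ∂μ from
    funext fun x => (hderiv x).deriv]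
  exact continuous_of_dominated (fun x => Continuous.aestronglyMeasurable (by fun_prop))
    (fun x => ae_of_all _ fun a => hb x a) (integrable_const _)
    (ae_of_all _ fun a => by fun_prop)

theorem arctanStepConv_sub (m x y : ℝ) : arctanStepConv μ m x - arctanStepConv μ m y =
    ∫ a, (arctanStep (m * (x - a)) - arctanStep (m * (y - a))) ∂μ :=
  (integral_sub (integrable_arctanStep μ m x) (integrable_arctanStep μ m y)).symm

theorem abs_arctanStepConv_le (m x : ℝ) : |arctanStepConv μ m x| ≤ μ.real univ := by
  have := norm_integral_le_of_norm_le_const (μ := μ) (f := fun a => arctanStep (m * (x - a)))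
    (C := 1) (ae_of_all _ fun a => by
      have := arctanStep_mem_Icc (m * (x - a))
      rw [Real.norm_of_nonneg this.1]
      exact this.2)
  rwa [one_mul] at this

theorem abs_arctanStepConv_sub_le (m x y : ℝ) :
    |arctanStepConv μ m x - arctanStepConv μ m y| ≤ |m| * μ.real univ * |x - y| := by
  rw [arctanStepConv_sub]
  have := norm_integral_le_of_norm_le_const (μ := μ)
    (f := fun a => arctanStep (m * (x - a)) - arctanStep (m * (y - a)))
    (C := |m| * |x - y|) (ae_of_all _ fun a => by
      refine (abs_arctanStep_sub_le _ _).trans_eq ?_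
      rw [← mul_sub, sub_sub_sub_cancel_right, abs_mul])
  rw [Real.norm_eq_abs] at this
  linarith

theorem enorm_arctanStepConv_sub_le {γ : ℝ} (hγ : 0 < γ) (hγ1 : γ < 1) {m : ℝ} (hm : 0 < m)
    (x y : ℝ) : ‖arctanStepConv μ m x - arctanStepConv μ m y‖ₑ ≤
      ‖x - y‖ₑ ^ γ * ∫⁻ a, 2 * ‖x - a‖ₑ ^ (-γ) ∂μ := by
  rw [arctanStepConv_sub, ← lintegral_const_mul _ (by fun_prop)]
  exact (enorm_integral_le_lintegral_enorm _).trans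
    (lintegral_mono fun a => enorm_arctanStep_sub_le hγ hγ1 hm x y a)

theorem tendsto_arctanStepConv {x : ℝ} (hx : μ {x} = 0) :
    Tendsto (fun n : ℕ => arctanStepConv μ ((n : ℝ) + 1) x) atTop (𝓝 (μ.real (Iic x))) := by
  have h1 : μ.real (Iic x) = ∫ a, (if 0 < x - a then 1 else 0 : ℝ) ∂μ := by
    rw [← integral_indicator_one measurableSet_Iic]
    refine integral_congr_ae ?_
    have : ∀ᵐ a ∂μ, a ≠ x := by simpa [ae_iff] using hx
    filter_upwards [this] with a ha
    rcases lt_or_gt_of_ne ha with h | h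
    · rw [if_pos (by linarith), indicator_of_mem (show a ∈ Iic x from h.le)]
      rfl
    · rw [if_neg (by linarith), indicator_of_notMem (show a ∉ Iic x from not_le.2 h)]
  rw [h1]
  refine tendsto_integral_of_dominated_convergence (fun _ => (1 : ℝ))
    (fun n => (integrable_arctanStep μ _ x).1) (integrable_const _)
    (fun n => ae_of_all _ fun a => ?_) ?_
  · have := arctanStep_mem_Icc (((n : ℝ) + 1) * (x - a))
    rw [Real.norm_of_nonneg this.1]
    exact this.2
  · have : ∀ᵐ a ∂μ, a ≠ x := by simpa [ae_iff] using hx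
    filter_upwards [this] with a ha
    exact tendsto_arctanStep_mul (sub_ne_zero.2 ha.symm)

end

theorem lintegral_enorm_rpow_neg_lt_top {γ : ℝ} (hγ1 : γ < 1) (R : ℝ) :
    ∫⁻ z in Icc (-R) R, ‖z‖ₑ ^ (-γ) < ∞ := by
  rcases lt_or_ge R 0 with hR | hR
  · rw [Icc_eq_empty (by linarith)]
    simp
  have h0 : IntervalIntegrable (fun z : ℝ => |z| ^ (-γ)) volume 0 R := by
    refine (intervalIntegral.intervalIntegrable_rpow' (r := -γ) (by linarith)).congr ?_
    intro z hz
    rw [uIoc_of_le hR] at hz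
    simp only [abs_of_pos hz.1]
  have h1 : IntervalIntegrable (fun z : ℝ => |z| ^ (-γ)) volume (-R) R := by
    refine IntervalIntegrable.trans (b := 0) ?_ h0
    have := (IntervalIntegrable.iff_comp_neg).1 h0
    simpa using this.symm
  have h2 := ((intervalIntegrable_iff_integrableOn_Icc_of_le (by linarith)).1 h1).2
  refine lt_of_le_of_lt (lintegral_mono_ae ?_) h2
  have hne : ∀ᵐ z ∂(volume : Measure ℝ), z ≠ 0 := by simp [ae_iff]
  filter_upwards [ae_restrict_of_ae hne] with z hz
  have hz' := abs_pos.2 hz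
  rw [Real.enorm_eq_ofReal_abs, ENNReal.ofReal_rpow_of_pos hz', Real.enorm_eq_ofReal_abs,
    abs_of_nonneg (Real.rpow_nonneg hz'.le _)]

/-- The Riesz potential of a finite measure of bounded support is locally integrable. -/
theorem lintegral_riesz_lt_top {γ : ℝ} (hγ1 : γ < 1) (M : ℝ) {R : ℝ} (hMR : M ≤ R)
    {μ : Measure ℝ} [IsFiniteMeasure μ] (hμ : ∀ᵐ a ∂μ, a ∈ Icc (-R) R) :
    ∫⁻ x in Icc (-M) M, ∫⁻ a, 2 * ‖x - a‖ₑ ^ (-γ) ∂μ < ∞ := by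
  rw [lintegral_lintegral_swap (by fun_prop)]
  set c := ∫⁻ z in Icc (-(2 * R)) (2 * R), ‖z‖ₑ ^ (-γ) with hc
  have hc' : c < ∞ := lintegral_enorm_rpow_neg_lt_top hγ1 _
  calc ∫⁻ a, (∫⁻ x in Icc (-M) M, 2 * ‖x - a‖ₑ ^ (-γ)) ∂μ
      ≤ ∫⁻ _a, 2 * c ∂μ := by
        refine lintegral_mono_ae ?_
        filter_upwards [hμ] with a ha
        rw [lintegral_const_mul _ (by fun_prop)]
        gcongr
        rw [hc, ← lintegral_indicator measurableSet_Icc, ← lintegral_indicator measurableSet_Icc,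
          ← lintegral_sub_right_eq_self
            ((Icc (-(2 * R)) (2 * R)).indicator fun z => ‖z‖ₑ ^ (-γ)) a]
        refine lintegral_mono fun x => ?_
        by_cases hx : x ∈ Icc (-M) M
        · rw [indicator_of_mem hx, indicator_of_mem]
          exact ⟨by linarith [hx.1, ha.2], by linarith [hx.2, ha.1]⟩
        · rw [indicator_of_notMem hx]
          exact zero_le
    _ = 2 * c * μ univ := lintegral_const _
    _ < ∞ := ENNReal.mul_lt_top (ENNReal.mul_lt_top (by simp) hc') (measure_lt_top _ _)

/-- Where its Stieltjes measure has no atom, a monotone function agrees with its right limit. -/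
theorem stieltjesFunction_eq_of_measure_singleton {p : ℝ → ℝ} (hp : Monotone p) {x : ℝ}
    (hx : hp.stieltjesFunction.measure {x} = 0) : hp.stieltjesFunction x = p x := by
  set S := hp.stieltjesFunction
  rw [StieltjesFunction.measure_singleton, ENNReal.ofReal_eq_zero] at hx
  have h1 : p x ≤ S x := hp.le_rightLim le_rfl
  have h2 : Function.leftLim S x ≤ p x := by
    refine le_of_tendsto (S.mono.tendsto_leftLim x) ?_
    filter_upwards [self_mem_nhdsWithin] with y hy
    exact hp.rightLim_le hy
  linarith

theorem exists_isFracApprox_of_monotone {γ : ℝ} (hγ : 0 < γ) (hγ1 : γ < 1) (M : ℝ) {p : ℝ → ℝ}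
    (hp : Monotone p) : ∃ H F, IsFracApprox γ M p H F := by
  set S := hp.stieltjesFunction with hS
  -- only the mass of the Stieltjes measure near `[-M, M]` matters, which makes `μ` finite
  set R := M + 1 with hR
  set μ := S.measure.restrict (Ioc (-R) R) with hμ
  have hfin : IsFiniteMeasure μ := ⟨by
    rw [hμ, Measure.restrict_apply_univ, StieltjesFunction.measure_Ioc]
    exact ENNReal.ofReal_lt_top⟩
  have hHm : Measurable fun x => ∫⁻ a, 2 * ‖x - a‖ₑ ^ (-γ) ∂μ :=
    Measurable.lintegral_prod_right (by fun_prop)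
  refine ⟨fun x => ∫⁻ a, 2 * ‖x - a‖ₑ ^ (-γ) ∂μ,
    fun n x => S (-R) + arctanStepConv μ ((n : ℝ) + 1) x, hHm, ?_, fun n => ?_, ?_, fun n => ?_,
    fun n x y => ?_, fun x hx hlt => ?_⟩
  · refine lintegral_riesz_lt_top hγ1 M (R := R) (by linarith) ?_
    exact (ae_restrict_iff' measurableSet_Ioc).2 (ae_of_all _ fun a ha => Ioc_subset_Icc_self ha)
  · exact contDiff_const.add (contDiff_arctanStepConv μ _)
  · exact ⟨|S (-R)| + μ.real univ, fun n x => (abs_add_le _ _).trans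
      (add_le_add le_rfl (abs_arctanStepConv_le μ _ x))⟩
  · refine ⟨|(n : ℝ) + 1| * μ.real univ, fun x y => ?_⟩
    rw [add_sub_add_left_eq_sub]
    exact abs_arctanStepConv_sub_le μ _ x y
  · rw [add_sub_add_left_eq_sub]
    exact enorm_arctanStepConv_sub_le μ hγ hγ1 (by positivity) x y
  · have hxR : x ∈ Ioc (-R) R := ⟨by linarith [hx.1], by linarith [hx.2]⟩
    -- an atom at `x` would make the potential infinite there, since `0 ^ (-γ) = ∞`
    have hatom : μ {x} = 0 := by
      have h1 := ae_lt_top (by fun_prop) hlt.ne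
      have h2 : ∀ᵐ a ∂μ, a ≠ x := by
        filter_upwards [h1] with a ha hax
        rw [hax, sub_self, enorm_zero, ENNReal.zero_rpow_of_neg (by linarith),
          ENNReal.mul_top (by simp)] at ha
        exact lt_irrefl _ ha
      simpa [ae_iff] using h2
    have hSx : S x = p x := by
      refine stieltjesFunction_eq_of_measure_singleton hp ?_
      rwa [hμ, Measure.restrict_apply (measurableSet_singleton x),
        inter_eq_left.2 (singleton_subset_iff.2 hxR)] at hatom
    have hreal : μ.real (Iic x) = S x - S (-R) := by
      rw [measureReal_def, hμ, Measure.restrict_apply measurableSet_Iic, inter_comm,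
        Ioc_inter_Iic, min_eq_right hxR.2, StieltjesFunction.measure_Ioc,
        ENNReal.toReal_ofReal (sub_nonneg.2 (S.mono hxR.1.le))]
    have := (tendsto_arctanStepConv μ hatom).const_add (S (-R))
    rwa [hreal, add_sub_cancel, hSx] at this

theorem exists_isFracApprox {γ : ℝ} (hγ : 0 < γ) (hγ1 : γ < 1) (M : ℝ) {p : ℝ → ℝ}
    (hp : LocallyBoundedVariationOn p univ) : ∃ H F, IsFracApprox γ M p H F := by
  obtain ⟨q, r, hq, hr, rfl⟩ := hp.exists_monotoneOn_sub_monotoneOn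
  obtain ⟨H, F, h⟩ := exists_isFracApprox_of_monotone hγ hγ1 M (monotoneOn_univ.1 hq)
  obtain ⟨H', F', h'⟩ := exists_isFracApprox_of_monotone hγ hγ1 M (monotoneOn_univ.1 hr)
  exact ⟨_, _, h.sub h'⟩

/-! ### The pathwise chain rule -/

theorem fracDerivLeft_congr {β s : ℝ} (hs : 0 ≤ s) {φ ψ : ℝ → ℝ} (h : ∀ u ∈ Icc 0 s, φ u = ψ u) :
    fracDerivLeft β φ s = fracDerivLeft β ψ s := by
  unfold fracDerivLeft
  rw [h s ⟨hs, le_rfl⟩]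
  congr 3
  refine intervalIntegral.integral_congr fun u hu => ?_
  rw [uIcc_of_le hs] at hu
  simp only [h u hu]

theorem fracDerivRight_congr {β s t : ℝ} (hst : s ≤ t) {φ ψ : ℝ → ℝ}
    (h : ∀ u ∈ Icc s t, φ u = ψ u) : fracDerivRight β t φ s = fracDerivRight β t ψ s := by
  rw [fracDerivRight_eq_fracDerivLeft, fracDerivRight_eq_fracDerivLeft]
  exact fracDerivLeft_congr (sub_nonneg.2 hst) fun u hu =>
    h _ ⟨by linarith [hu.2], by linarith [hu.1]⟩

theorem lintegral_const_mul_sub_rpow {r : ℝ} (hr : -1 < r) {s : ℝ} (hs : 0 ≤ s) {K : ℝ}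
    (hK : 0 ≤ K) :
    ∫⁻ u in Ioc 0 s, ENNReal.ofReal (K * (s - u) ^ r) =
      ENNReal.ofReal (K * (s ^ (r + 1) / (r + 1))) := by
  rw [← integral_sub_rpow hr s, ← intervalIntegral.integral_const_mul,
    intervalIntegral.integral_of_le hs, ofReal_integral_eq_lintegral_ofReal]
  · exact ((intervalIntegrable_iff_integrableOn_Ioc_of_le hs).1
      (intervalIntegrable_sub_rpow hr s)).const_mul K
  · refine (ae_restrict_iff' measurableSet_Ioc).2 (ae_of_all _ fun u hu => ?_)
    exact mul_nonneg hK (Real.rpow_nonneg (sub_nonneg.2 hu.2) _)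

theorem lintegral_const_mul_rpow_sub {r : ℝ} (hr : -1 < r) {s t : ℝ} (hst : s ≤ t) {K : ℝ}
    (hK : 0 ≤ K) :
    ∫⁻ u in Ioc s t, ENNReal.ofReal (K * (u - s) ^ r) =
      ENNReal.ofReal (K * ((t - s) ^ (r + 1) / (r + 1))) := by
  have hint : IntervalIntegrable (fun u => (u - s) ^ r) volume s t := by
    have := (intervalIntegral.intervalIntegrable_rpow' (a := 0) (b := t - s) hr).comp_sub_right s
    simpa using this
  have h1 : ∫ u in s..t, (u - s) ^ r = (t - s) ^ (r + 1) / (r + 1) := by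
    rw [intervalIntegral.integral_comp_sub_right (fun x => x ^ r) s, sub_self,
      integral_rpow (Or.inl hr), Real.zero_rpow (by linarith), sub_zero]
  rw [← h1, ← intervalIntegral.integral_const_mul, intervalIntegral.integral_of_le hst,
    ofReal_integral_eq_lintegral_ofReal]
  · exact ((intervalIntegrable_iff_integrableOn_Ioc_of_le hst).1 hint).const_mul K
  · refine (ae_restrict_iff' measurableSet_Ioc).2 (ae_of_all _ fun u hu => ?_)
    exact mul_nonneg hK (Real.rpow_nonneg (sub_nonneg.2 hu.1.le) _)

theorem besovNormOne_lt_top {T η α C : ℝ} {g : ℝ → ℝ} (hη : η < α) (hC : 0 ≤ C)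
    (hg : ∀ u ∈ Icc 0 T, ∀ v ∈ Icc 0 T, |g u - g v| ≤ C * |u - v| ^ α) :
    besovNormOne T η g < ∞ := by
  unfold besovNormOne
  refine lt_of_le_of_lt (b := ENNReal.ofReal (C * T ^ (α - η)) +
    ENNReal.ofReal (C * (T ^ (α - η) / (α - η)))) ?_ (by simp)
  refine iSup_le fun s => iSup_le fun t => iSup_le fun hs => iSup_le fun hst => iSup_le fun ht => ?_
  have hαη : 0 < α - η := by linarith
  have hts : 0 < t - s := sub_pos.2 hst
  have hle : (t - s) ^ (α - η) ≤ T ^ (α - η) :=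
    Real.rpow_le_rpow hts.le (by linarith) hαη.le
  have hbd : ∀ u, s < u → u ≤ t → |g u - g s| ≤ C * (u - s) ^ α := fun u hsu hut => by
    have := hg u ⟨by linarith, by linarith⟩ s ⟨hs, by linarith⟩
    rwa [abs_of_pos (sub_pos.2 hsu)] at this
  refine add_le_add (ENNReal.ofReal_le_ofReal ?_) ?_
  · rw [div_le_iff₀ (Real.rpow_pos_of_pos hts _)]
    calc |g t - g s| ≤ C * (t - s) ^ α := hbd t hst le_rfl
      _ = C * (t - s) ^ (α - η) * (t - s) ^ η := by
        rw [mul_assoc, ← Real.rpow_add hts, sub_add_cancel]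
      _ ≤ _ := by gcongr
  · calc ∫⁻ u in Ioc s t, ENNReal.ofReal (|g u - g s| / (u - s) ^ (1 + η))
        ≤ ∫⁻ u in Ioc s t, ENNReal.ofReal (C * (u - s) ^ (α - η - 1)) := by
          refine setLIntegral_mono (by fun_prop) fun u hu => ENNReal.ofReal_le_ofReal ?_
          have hus : 0 < u - s := sub_pos.2 hu.1
          rw [div_le_iff₀ (Real.rpow_pos_of_pos hus _), mul_assoc, ← Real.rpow_add hus,
            show α - η - 1 + (1 + η) = α by ring]
          exact hbd u hu.1 hu.2
      _ = ENNReal.ofReal (C * ((t - s) ^ (α - η) / (α - η))) := by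
          rw [lintegral_const_mul_rpow_sub (by linarith) hst.le hC, sub_add_cancel]
      _ ≤ _ := ENNReal.ofReal_le_ofReal (by gcongr)

theorem besovNormTwo_lt_top {T β δ A : ℝ} {φ H : ℝ → ℝ} (hβ1 : β < 1) (hδ : β < δ)
    (hT : 0 ≤ T) (hA : ∀ᵐ s ∂volume.restrict (Ioc 0 T), |φ s| ≤ A) (hH0 : ∀ s, 0 ≤ H s)
    (hH : IntegrableOn H (Ioc 0 T))
    (h : ∀ᵐ s ∂volume.restrict (Ioc 0 T), ∀ᵐ u ∂volume.restrict (Ioc 0 s),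
      |φ s - φ u| ≤ H s * (s - u) ^ δ) :
    besovNormTwo T β φ < ∞ := by
  have hδβ : 0 < δ - β := by linarith
  unfold besovNormTwo
  refine ENNReal.add_lt_top.2 ⟨?_, ?_⟩
  · have hint : IntegrableOn (fun s : ℝ => A * s ^ (-β)) (Ioc 0 T) :=
      ((intervalIntegrable_iff_integrableOn_Ioc_of_le hT).1
        (intervalIntegral.intervalIntegrable_rpow' (by linarith))).const_mul A
    refine lt_of_le_of_lt (lintegral_mono_ae ?_) hint.lintegral_lt_top
    filter_upwards [hA, ae_restrict_mem measurableSet_Ioc] with s hs hmem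
    refine ENNReal.ofReal_le_ofReal ?_
    rw [Real.rpow_neg hmem.1.le, ← div_eq_mul_inv]
    have := Real.rpow_nonneg hmem.1.le β
    gcongr
  · have hint : IntegrableOn (fun s => H s * (T ^ (δ - β) / (δ - β))) (Ioc 0 T) :=
      hH.mul_const _
    refine lt_of_le_of_lt (lintegral_mono_ae ?_) hint.lintegral_lt_top
    filter_upwards [h, ae_restrict_mem measurableSet_Ioc] with s hs hmem
    calc ∫⁻ u in Ioc 0 s, ENNReal.ofReal (|φ u - φ s| / (s - u) ^ (1 + β))
        ≤ ∫⁻ u in Ioc 0 s, ENNReal.ofReal (H s * (s - u) ^ (δ - β - 1)) := by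
          refine lintegral_mono_ae ?_
          filter_upwards [hs, ae_restrict_Ioc_ne s] with u hu hne
          refine ENNReal.ofReal_le_ofReal ?_
          have hus : 0 < s - u := sub_pos.2 hne.2
          rw [div_le_iff₀ (Real.rpow_pos_of_pos hus _), mul_assoc, ← Real.rpow_add hus,
            show δ - β - 1 + (1 + β) = δ by ring, abs_sub_comm]
          exact hu
      _ = ENNReal.ofReal (H s * (s ^ (δ - β) / (δ - β))) := by
          rw [lintegral_const_mul_sub_rpow (by linarith) hmem.1.le (hH0 s), sub_add_cancel]
      _ ≤ _ := by
          refine ENNReal.ofReal_le_ofReal (mul_le_mul_of_nonneg_left ?_ (hH0 s))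
          exact div_le_div_of_nonneg_right (Real.rpow_le_rpow hmem.1.le hmem.2 hδβ.le) hδβ.le

theorem besovNormTwo_congr {T β : ℝ} {φ ψ : ℝ → ℝ} (h : ∀ s ∈ Ioc 0 T, φ s = ψ s) :
    besovNormTwo T β φ = besovNormTwo T β ψ := by
  unfold besovNormTwo
  congr 1
  · exact setLIntegral_congr_fun measurableSet_Ioc fun s hs => by simp only [h s hs]
  · refine setLIntegral_congr_fun measurableSet_Ioc fun s hs => ?_
    refine setLIntegral_congr_fun measurableSet_Ioc fun u hu => ?_
    simp only [h s hs, h u ⟨hu.1, hu.2.trans hs.2⟩]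

/-- The pathwise chain rule for a Hölder continuous path `x` defined on all of `ℝ`. The only
condition linking the path to the integrand `f'` is that the potential `H` is integrable along the
path. The conclusion lists existence and value of the integral. -/
theorem fracDeriv_chainRule {T α β γ M C : ℝ} {x f' : ℝ → ℝ} {H : ℝ → ℝ≥0∞} {F : ℕ → ℝ → ℝ}
    (hT : 0 < T) (hβ : 0 < β) (hβ1 : β < 1) (hγ : 0 < γ) (hαβ : β < α) (hα : 1 - β < α)
    (hαγ : β < α * γ) (hC : 0 ≤ C) (hx : Continuous x)
    (hxC : ∀ s u, |x s - x u| ≤ C * |s - u| ^ α) (hM : ∀ s, x s ∈ Icc (-M) M)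
    (hf' : Measurable f') (hF : IsFracApprox γ M f' H F)
    (hH : ∫⁻ s in Ioc 0 T, H (x s) < ∞) :
    besovNormTwo T β (fun s => f' (x s)) < ∞ ∧ ∀ t ∈ Icc 0 T,
      IntervalIntegrable (fun s => fracDerivLeft β (fun u => f' (x u)) s *
        fracDerivRight (1 - β) t (fun u => x u - x t) s) volume 0 t ∧
      ∫ s in (0 : ℝ)..t, fracDerivLeft β (fun u => f' (x u)) s *
        fracDerivRight (1 - β) t (fun u => x u - x t) s =
          -((∫ y in (0 : ℝ)..x t, f' y) - ∫ y in (0 : ℝ)..x 0, f' y) := by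
  obtain ⟨K, hK⟩ := hF.bounded
  have hHx : Measurable fun s => H (x s) := hF.measurable.comp hx.measurable
  have hfin : ∀ᵐ s ∂volume.restrict (Ioc 0 T), H (x s) < ∞ := ae_lt_top hHx hH.ne
  set h : ℝ → ℝ := fun s => C ^ γ * (H (x s)).toReal with hh
  have hh0 : ∀ s, 0 ≤ h s := fun s =>
    mul_nonneg (Real.rpow_nonneg hC _) ENNReal.toReal_nonneg
  have hhint : IntegrableOn h (Ioc 0 T) :=
    (integrable_toReal_of_lintegral_ne_top hHx.aemeasurable hH.ne).const_mul _
  have hlim : ∀ᵐ s ∂volume.restrict (Ioc 0 T),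
      Tendsto (fun n => F n (x s)) atTop (𝓝 (f' (x s))) := by
    filter_upwards [hfin] with s hs
    exact hF.tendsto _ (hM s) hs
  have hFbd : ∀ n, ∀ᵐ s ∂volume.restrict (Ioc 0 T), ∀ u ≤ s,
      |F n (x s) - F n (x u)| ≤ h s * (s - u) ^ (α * γ) := by
    intro n
    filter_upwards [hfin] with s hs u hus
    have h1 := hF.enorm_sub_le n (x s) (x u)
    have hsu : 0 ≤ s - u := sub_nonneg.2 hus
    have h2 : |F n (x s) - F n (x u)| ≤ |x s - x u| ^ γ * (H (x s)).toReal := by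
      have := ENNReal.toReal_mono (ENNReal.mul_ne_top
        (ENNReal.rpow_ne_top_of_nonneg hγ.le enorm_ne_top) hs.ne) h1
      rwa [ENNReal.toReal_mul, ← ENNReal.toReal_rpow, toReal_enorm, toReal_enorm,
        Real.norm_eq_abs, Real.norm_eq_abs] at this
    have h3 : |x s - x u| ^ γ ≤ C ^ γ * (s - u) ^ (α * γ) := by
      rw [Real.rpow_mul hsu, ← Real.mul_rpow hC (Real.rpow_nonneg hsu _)]
      refine Real.rpow_le_rpow (abs_nonneg _) ?_ hγ.le
      have := hxC s u
      rwa [abs_of_nonneg hsu] at this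
    calc |F n (x s) - F n (x u)| ≤ |x s - x u| ^ γ * (H (x s)).toReal := h2
      _ ≤ C ^ γ * (s - u) ^ (α * γ) * (H (x s)).toReal :=
          mul_le_mul_of_nonneg_right h3 ENNReal.toReal_nonneg
      _ = _ := by rw [hh]; ring
  have hf'K : ∀ᵐ s ∂volume.restrict (Ioc 0 T), |f' (x s)| ≤ K := by
    filter_upwards [hlim] with s hs
    exact le_of_tendsto' hs.abs fun n => hK n _
  have hf'bd : ∀ᵐ s ∂volume.restrict (Ioc 0 T), ∀ᵐ u ∂volume.restrict (Ioc 0 s),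
      |f' (x s) - f' (x u)| ≤ h s * (s - u) ^ (α * γ) := by
    filter_upwards [hlim, ae_all_iff.2 hFbd, ae_restrict_mem measurableSet_Ioc] with s hs hbd hmem
    filter_upwards [ae_restrict_mem measurableSet_Ioc,
      ae_mono (Measure.restrict_mono (Ioc_subset_Ioc_right hmem.2) le_rfl) hlim] with u hu hul
    exact le_of_tendsto' (hs.sub hul).abs fun n => hbd n u hu.2
  refine ⟨besovNormTwo_lt_top hβ1 hαγ hT.le hf'K hh0 hhint hf'bd, fun t ht => ?_⟩
  have hsub : Ioc 0 t ⊆ Ioc 0 T := Ioc_subset_Ioc_right ht.2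
  have hmono := Measure.restrict_mono hsub (le_refl (volume : Measure ℝ))
  have hxt : ∀ u v, |x u - x t - (x v - x t)| ≤ C * |u - v| ^ α := fun u v => by
    rw [sub_sub_sub_cancel_right]
    exact hxC u v
  refine ⟨intervalIntegrable_fracDeriv_mul hβ hβ1 hαγ hα hC ht.1 (hf'.comp hx.measurable)
    (hx.sub continuous_const).measurable (ae_mono hmono hf'K) (hhint.mono_set hsub)
    (ae_mono hmono hf'bd) (sub_self _) fun u _ v _ => hxt u v, ?_⟩
  have h1 : Tendsto (fun n => ∫ s in (0 : ℝ)..t, fracDerivLeft β (fun u => F n (x u)) s *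
      fracDerivRight (1 - β) t (fun u => x u - x t) s) atTop
      (𝓝 (∫ s in (0 : ℝ)..t, fracDerivLeft β (fun u => f' (x u)) s *
        fracDerivRight (1 - β) t (fun u => x u - x t) s)) := by
    refine tendsto_integral_fracDeriv_mul (δ := α * γ) (A := K) (H := h) hβ hβ1 hαγ hα hC ht.1
      (fun n => ((hF.contDiff n).continuous.comp hx).measurable)
      (fun _ => (hx.sub continuous_const).measurable) (fun n => ae_of_all _ fun s => hK n _)
      (hhint.mono_set hsub) (fun n => ?_) (ae_mono hmono hlim) (fun _ => sub_self _)
      (fun _ u _ v _ => hxt u v) fun u _ => tendsto_const_nhds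
    filter_upwards [ae_mono hmono (hFbd n)] with s hs
    filter_upwards [ae_restrict_mem measurableSet_Ioc] with u hu
    exact hs u hu.2
  have h2 : ∀ n, ∫ s in (0 : ℝ)..t, fracDerivLeft β (fun u => F n (x u)) s *
      fracDerivRight (1 - β) t (fun u => x u - x t) s =
      -((∫ y in (0 : ℝ)..x t, F n y) - ∫ y in (0 : ℝ)..x 0, F n y) := by
    intro n
    obtain ⟨L, hL⟩ := hF.lipschitz n
    have hc := (hF.contDiff n).continuous
    rw [integral_fracDeriv_comp_mul hβ hβ1 hαβ hα ht.1 hC (hF.contDiff n) (hK n) hL hx hxC,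
      intervalIntegral.integral_interval_sub_left (hc.intervalIntegrable _ _)
      (hc.intervalIntegrable _ _)]
  have hHae : ∀ᵐ y ∂volume.restrict (Icc (-M) M), H y < ∞ :=
    ae_lt_top hF.measurable hF.lintegral_lt_top.ne
  have h3 : ∀ z ∈ Icc (-M) M, Tendsto (fun n => ∫ y in (0 : ℝ)..z, F n y) atTop
      (𝓝 (∫ y in (0 : ℝ)..z, f' y)) := by
    intro z hz
    have h0 : (0 : ℝ) ∈ Icc (-M) M := ⟨by linarith [hz.1, hz.2], by linarith [hz.1, hz.2]⟩
    refine intervalIntegral.tendsto_integral_filter_of_dominated_convergence (fun _ => K)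
      (Eventually.of_forall fun n => (hF.contDiff n).continuous.aestronglyMeasurable)
      (Eventually.of_forall fun n => ae_of_all _ fun y _ => hK n y) (by simp) ?_
    rw [ae_restrict_iff' measurableSet_Icc] at hHae
    filter_upwards [hHae] with y hy hyz
    have hyM : y ∈ Icc (-M) M := (uIcc_subset_Icc h0 hz) (uIoc_subset_uIcc hyz)
    exact hF.tendsto y hyM (hy hyM)
  simp only [h2] at h1
  exact tendsto_nhds_unique h1 ((h3 _ (hM t)).sub (h3 _ (hM 0))).neg

/-- The left limit at `t ∈ (0, T]` of a function continuous on `[0, T]`. -/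
theorem leftLim_eq_of_continuousOn {T t : ℝ} {x : ℝ → ℝ} (hx : ContinuousOn x (Icc 0 T))
    (ht0 : 0 < t) (htT : t ≤ T) : Function.leftLim x t = x t := by
  refine leftLim_eq_of_tendsto ?_
  refine (hx t ⟨ht0.le, htT⟩).tendsto.mono_left (nhdsWithin_le_iff.2 ?_)
  filter_upwards [Ioo_mem_nhdsLT ht0] with u hu
  exact ⟨hu.1.le, hu.2.le.trans htT⟩

/-- The pathwise chain rule for a path that is Hölder continuous on `[0, T]`. -/
theorem hasGLSIntegral_comp {T β γ M : ℝ} {α C : ℝ≥0} {x f' : ℝ → ℝ} {H : ℝ → ℝ≥0∞}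
    {F : ℕ → ℝ → ℝ} (hT : 0 < T) (hβ : 0 < β) (hβ1 : β < 1) (hγ : 0 < γ) (hαβ : β < α)
    (hα : 1 - β < α) (hαγ : β < α * γ) (hx : HolderOnWith C α x (Icc 0 T))
    (hM : ∀ s ∈ Icc 0 T, x s ∈ Icc (-M) M) (hf' : Measurable f') (hF : IsFracApprox γ M f' H F)
    (hH : ∫⁻ s in Ioc 0 T, H (x s) < ∞) {t : ℝ} (ht : t ∈ Icc 0 T) :
    HasGLSIntegral T β (fun s => f' (x s)) x t
      ((∫ y in (0 : ℝ)..x t, f' y) - ∫ y in (0 : ℝ)..x 0, f' y) := by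
  have hα0 : 0 < α := by
    have : (0 : ℝ) < α := hβ.trans hαβ
    exact_mod_cast this
  have hxc : ContinuousOn x (Icc 0 T) := hx.continuousOn hα0
  have hxC : ∀ u ∈ Icc 0 T, ∀ v ∈ Icc 0 T, |x u - x v| ≤ C * |u - v| ^ (α : ℝ) := by
    intro u hu v hv
    have := hx.dist_le hu hv
    rwa [Real.dist_eq, Real.dist_eq] at this
  -- the path is extended by constants to all of `ℝ`
  set y : ℝ → ℝ := fun s => x (projIcc 0 T hT.le s) with hy
  have hyx : ∀ s ∈ Icc 0 T, y s = x s := fun s hs => by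
    rw [hy]
    simp only [projIcc_of_mem hT.le hs]
  have hyC : ∀ s u, |y s - y u| ≤ C * |s - u| ^ (α : ℝ) := fun s u =>
    (hxC _ (projIcc 0 T hT.le s).2 _ (projIcc 0 T hT.le u).2).trans
      (mul_le_mul_of_nonneg_left (Real.rpow_le_rpow (abs_nonneg _)
        (abs_projIcc_sub_projIcc hT.le) α.2) C.2)
  have hyc : Continuous y := hxc.comp_continuous (continuous_subtype_val.comp continuous_projIcc)
    fun s => (projIcc 0 T hT.le s).2
  have hHy : ∫⁻ s in Ioc 0 T, H (y s) < ∞ := by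
    refine lt_of_eq_of_lt (setLIntegral_congr_fun measurableSet_Ioc fun s hs => ?_) hH
    simp only [hyx s (Ioc_subset_Icc_self hs)]
  obtain ⟨hB, hI⟩ := fracDeriv_chainRule hT hβ hβ1 hγ hαβ hα hαγ C.2 hyc hyC
    (fun s => hM _ (projIcc 0 T hT.le s).2) hf' hF hHy
  obtain ⟨hI1, hI2⟩ := hI t ht
  have hcongr : ∀ s ∈ uIoc 0 t, fracDerivLeft β (fun u => f' (y u)) s *
      fracDerivRight (1 - β) t (fun u => y u - y t) s =
      glsIntegrand β (fun s => f' (x s)) x t s := by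
    intro s hs
    rw [uIoc_of_le ht.1] at hs
    have ht0 : 0 < t := hs.1.trans_le hs.2
    unfold glsIntegrand
    rw [leftLim_eq_of_continuousOn hxc ht0 ht.2]
    congr 1
    · refine fracDerivLeft_congr hs.1.le fun u hu => ?_
      rw [hyx u ⟨hu.1, hu.2.trans (hs.2.trans ht.2)⟩]
    · refine fracDerivRight_congr hs.2 fun u hu => ?_
      rw [hyx u ⟨hs.1.le.trans hu.1, hu.2.trans ht.2⟩, hyx t ht]
  have hxr : Continuous ((Icc 0 T).domRestrict x) := hxc.domRestrict
  refine ⟨hβ, hβ1, ⟨hf'.comp hxr.measurable, ?_⟩, ⟨hxr.measurable, ?_⟩, hI1.congr hcongr, ?_⟩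
  · rwa [besovNormTwo_congr (ψ := fun s => f' (y s)) fun s hs => by
      rw [hyx s (Ioc_subset_Icc_self hs)]]
  · exact besovNormOne_lt_top hα C.2 hxC
  · unfold glsValue
    rw [← intervalIntegral.integral_congr_ae (ae_of_all _ hcongr), hI2, neg_neg, hyx t ht,
      hyx 0 ⟨le_rfl, hT.le⟩]

/-! ### Processes with integrably bounded densities -/

theorem measurable_of_locallyBoundedVariationOn {p : ℝ → ℝ}
    (hp : LocallyBoundedVariationOn p univ) : Measurable p := by
  obtain ⟨q, r, hq, hr, rfl⟩ := hp.exists_monotoneOn_sub_monotoneOn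
  exact (monotoneOn_univ.1 hq).measurable.sub (monotoneOn_univ.1 hr).measurable

/-- `E H(Z) ≤ c ∫ H` if `Z` has a density bounded by `c`. -/
theorem lintegral_comp_le_of_density {Ω : Type*} [MeasurableSpace Ω] {P : Measure Ω} {Z : Ω → ℝ}
    (hZ : Measurable Z) {p : ℝ → ℝ} (hp : Measurable p) {c : ℝ} (hpc : ∀ y, p y ≤ c)
    (hlaw : P.map Z = volume.withDensity (fun y => ENNReal.ofReal (p y)))
    {H : ℝ → ℝ≥0∞} (hH : Measurable H) :
    ∫⁻ ω, H (Z ω) ∂P ≤ ENNReal.ofReal c * ∫⁻ y, H y := by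
  rw [← lintegral_map hH hZ, hlaw, lintegral_withDensity_eq_lintegral_mul _ hp.ennreal_ofReal hH,
    ← lintegral_const_mul _ hH]
  exact lintegral_mono fun y => mul_le_mul_left (ENNReal.ofReal_le_ofReal (hpc y)) _

/-- Along almost every path of a process with integrably bounded densities, every Lebesgue
integrable potential is integrable. -/
theorem HasIntegrablyBoundedDensities.ae_lintegral_lt_top {Ω : Type*} [MeasurableSpace Ω]
    {P : Measure Ω} [IsProbabilityMeasure P] {T : ℝ} (hT : 0 < T) {X : ℝ → Ω → ℝ}
    (hXmeas : ∀ t ∈ Icc 0 T, Measurable (X t))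
    (hXcont : ∀ᵐ ω ∂P, ContinuousOn (fun t => X t ω) (Icc 0 T))
    (hXdens : HasIntegrablyBoundedDensities P T X) {H : ℝ → ℝ≥0∞} (hH : Measurable H)
    (hHfin : ∫⁻ y, H y < ∞) :
    ∀ᵐ ω ∂P, ∫⁻ s in Ioc 0 T, H (X s ω) < ∞ := by
  obtain ⟨b, hb, hdens⟩ := hXdens
  obtain ⟨N, hsub, hN, hPN⟩ := exists_measurable_superset_of_null (ae_iff.1 hXcont)
  -- a jointly measurable modification of the process
  set Y : ℝ → Ω → ℝ := fun s => Nᶜ.indicator (X (projIcc 0 T hT.le s)) with hY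
  have hYX : ∀ s ∈ Icc 0 T, ∀ ω ∉ N, Y s ω = X s ω := by
    intro s hs ω hω
    rw [hY]
    simp only [projIcc_of_mem hT.le hs]
    exact indicator_of_mem (s := Nᶜ) hω _
  have hYm : Measurable (Function.uncurry Y) := by
    refine measurable_uncurry_of_continuous_of_measurable (fun ω => ?_) fun s =>
      (hXmeas _ (projIcc 0 T hT.le s).2).indicator hN.compl
    by_cases hω : ω ∈ N
    · have : (fun s => Y s ω) = fun _ => 0 := by
        funext s
        exact indicator_of_notMem (s := Nᶜ) (not_not.2 hω) _
      rw [this]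
      exact continuous_const
    · have hc : ContinuousOn (fun t => X t ω) (Icc 0 T) := by
        by_contra h
        exact hω (hsub h)
      have : (fun s => Y s ω) = fun s => X (projIcc 0 T hT.le s) ω := by
        funext s
        exact indicator_of_mem (s := Nᶜ) hω _
      rw [this]
      exact hc.comp_continuous (continuous_subtype_val.comp continuous_projIcc)
        fun s => (projIcc 0 T hT.le s).2
  have hae : ∀ᵐ ω ∂P, ω ∉ N := measure_eq_zero_iff_ae_notMem.1 hPN
  have hHY : Measurable (Function.uncurry fun ω s => H (Y s ω)) :=
    hH.comp (hYm.comp measurable_swap)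
  have hbound : ∫⁻ ω, (∫⁻ s in Ioc 0 T, H (Y s ω)) ∂P < ∞ := by
    rw [lintegral_lintegral_swap hHY.aemeasurable]
    calc ∫⁻ s in Ioc 0 T, (∫⁻ ω, H (Y s ω) ∂P)
        ≤ ∫⁻ s in Ioc 0 T, ENNReal.ofReal (b s) * ∫⁻ y, H y := by
          refine lintegral_mono_ae ?_
          filter_upwards [ae_mono (Measure.restrict_mono Ioc_subset_Icc_self le_rfl) hdens,
            ae_restrict_mem measurableSet_Ioc] with s ⟨p, hp, _, hpb, hlaw⟩ hs
          refine le_trans (le_of_eq (lintegral_congr_ae ?_)) (lintegral_comp_le_of_density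
            (hXmeas s (Ioc_subset_Icc_self hs)) hp hpb hlaw hH)
          filter_upwards [hae] with ω hω
          rw [hYX s (Ioc_subset_Icc_self hs) ω hω]
      _ = (∫⁻ s in Ioc 0 T, ENNReal.ofReal (b s)) * ∫⁻ y, H y :=
          lintegral_mul_const' _ _ hHfin.ne
      _ < ∞ := ENNReal.mul_lt_top (hb.mono_set Ioc_subset_Icc_self).lintegral_lt_top hHfin
  filter_upwards [ae_lt_top hHY.lintegral_prod_right hbound.ne, hae] with ω hlt hω
  refine lt_of_eq_of_lt (setLIntegral_congr_fun measurableSet_Ioc fun s hs => ?_) hlt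
  simp only [hYX s (Ioc_subset_Icc_self hs) ω hω]

theorem theorem3p6 {Ω : Type*} [MeasurableSpace Ω] (P : Measure Ω) [IsProbabilityMeasure P]
    (T : ℝ) (hT : 0 < T) (α : ℝ≥0) (hα : 1 / 2 < (α : ℝ))
    (X : ℝ → Ω → ℝ) (hXmeas : ∀ t ∈ Icc 0 T, Measurable (X t))
    (hXhol : ∀ᵐ ω ∂P, ∃ C : ℝ≥0, HolderOnWith C α (fun t => X t ω) (Icc 0 T))
    (hXdens : HasIntegrablyBoundedDensities P T X)
    (f f' : ℝ → ℝ) (hf' : LocallyBoundedVariationOn f' univ)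
    (hf : ∀ x, f x = ∫ y in (0 : ℝ)..x, f' y) :
    ∀ᵐ ω ∂P, ∀ β : ℝ, 0 < β → β < 1 → 1 - (α : ℝ) < β → β < (α : ℝ) → ∀ t ∈ Icc 0 T,
      HasGLSIntegral T β (fun s => f' (X s ω)) (fun s => X s ω) t (f (X t ω) - f (X 0 ω)) := by
  have hα0 : (0 : ℝ) < α := by linarith
  have hXcont : ∀ᵐ ω ∂P, ContinuousOn (fun t => X t ω) (Icc 0 T) := by
    filter_upwards [hXhol] with ω ⟨C, hC⟩
    exact hC.continuousOn (by exact_mod_cast hα0)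
  -- Countably many exponents `γ k ↑ 1` and windows `[-M, M]` suffice, so that the exceptional
  -- null set depends neither on `β` nor on the path.
  set γ : ℕ → ℝ := fun k => 1 - 1 / ((k : ℝ) + 2) with hγ
  have hk0 : ∀ k : ℕ, (0 : ℝ) < 1 / ((k : ℝ) + 2) := fun k => by positivity
  have hγ0 : ∀ k, 0 < γ k := fun k => by
    have : 1 / ((k : ℝ) + 2) < 1 := by
      rw [div_lt_one (by positivity)]
      have : (0 : ℝ) ≤ k := Nat.cast_nonneg k
      linarith
    simp only [hγ]
    linarith
  have hγ1 : ∀ k, γ k < 1 := fun k => sub_lt_self _ (hk0 k)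
  choose H F hF using fun (k M : ℕ) => exists_isFracApprox (hγ0 k) (hγ1 k) (M : ℝ) hf'
  have hint : ∀ᵐ ω ∂P, ∀ k M : ℕ,
      ∫⁻ s in Ioc 0 T, (Icc (-(M : ℝ)) M).indicator (H k M) (X s ω) < ∞ := by
    refine ae_all_iff.2 fun k => ae_all_iff.2 fun M => ?_
    refine hXdens.ae_lintegral_lt_top hT hXmeas hXcont
      ((hF k M).measurable.indicator measurableSet_Icc) ?_
    rw [lintegral_indicator measurableSet_Icc]
    exact (hF k M).lintegral_lt_top
  filter_upwards [hXhol, hXcont, hint] with ω ⟨C, hC⟩ hcont hω β hβ hβ1 hβα hαβ t ht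
  obtain ⟨B, hB⟩ := isCompact_Icc.exists_bound_of_continuousOn hcont
  obtain ⟨M, hM⟩ := exists_nat_ge B
  have hXM : ∀ s ∈ Icc 0 T, X s ω ∈ Icc (-(M : ℝ)) M := fun s hs =>
    abs_le.1 ((hB s hs).trans hM)
  obtain ⟨k, hk⟩ := exists_nat_one_div_lt (div_pos (sub_pos.2 hαβ) hα0)
  have hαγ : β < α * γ k := by
    have h1 : 1 / ((k : ℝ) + 2) ≤ 1 / ((k : ℝ) + 1) :=
      one_div_le_one_div_of_le (by positivity) (by linarith)
    have h2 := (lt_div_iff₀ hα0).1 (h1.trans_lt hk)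
    simp only [hγ]
    linarith
  rw [hf, hf]
  refine hasGLSIntegral_comp hT hβ hβ1 (hγ0 k) hαβ (by linarith) hαγ hC hXM
    (measurable_of_locallyBoundedVariationOn hf') (hF k M) ?_ ht
  refine lt_of_eq_of_lt (setLIntegral_congr_fun measurableSet_Ioc fun s hs => ?_) (hω k M)
  exact (indicator_of_mem (hXM s (Ioc_subset_Icc_self hs)) _).symm
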